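/- Let $\mathcal{T}$ be a set of primes for which there are real constants $\tau, C$ with $0<\tau<1$ and $$\sum_{\substack{p\le x\\ p\in\mathcal{T}}}\frac{\log p}{p}=\tau\log x+C+o(1)\qquad (x\to\infty),$$ and let $\mathcal{Q}(\mathcal{T})$ be the set of positive integers $n$ such that every prime $p$ dividing $n$ belongs to $\mathcal{T}$. Then $\mathcal{Q}(\mathcal{T})$ cannot be asymptotically decomposed into three sets with at least two elements each. That is, there do not exist sets $\mathcal{A},\mathcal{B},\mathcal{C}$ of positive integers (finite or infinite), with at least two elements each, and a number $x_0$, such that $$(\mathcal{A}+\mathcal{B}+\mathcal{C})\cap[x_0,\infty)=\mathcal{Q}(\mathcal{T})\cap[x_0,\infty),$$ where $\mathcal{A}+\mathcal{B}+\mathcal{C}=\{a+b+c : a\in\mathcal{A},\ b\in\mathcal{B},\ c\in\mathcal{C}\}$. -/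

import Mathlib

open Filter Asymptotics
open scoped Pointwise

namespace AdditiveDecomposition

/-- The positive integers all of whose prime factors lie in `T`. -/
def Q (T : Set ℕ) : Set ℕ :=
  {n | 0 < n ∧ ∀ p : ℕ, p.Prime → p ∣ n → p ∈ T}

/-- The relation `S ∼ S'`: the two sets have the same elements from some point `x₀` on. -/
def AsympEq (S S' : Set ℕ) : Prop :=
  ∃ x₀ : ℕ, S ∩ Set.Ici x₀ = S' ∩ Set.Ici x₀

/-- A set of positive integers (finite or infinite) with at least two elements. -/
def IsSummand (A : Set ℕ) : Prop :=
  (∀ a ∈ A, 0 < a) ∧ 2 ≤ A.encard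

/-- `S ∼ A + B + C` for some sets `A`, `B`, `C` of positive integers with at least two elements
each, where `A + B + C` is the sumset `{a + b + c : a ∈ A, b ∈ B, c ∈ C}`. -/
def HasTernaryDecomposition (S : Set ℕ) : Prop :=
  ∃ A B C : Set ℕ, IsSummand A ∧ IsSummand B ∧ IsSummand C ∧ AsympEq (A + B + C) S

open Classical in
/-- The sum of `(log p) / p` over the elements `p ≤ x` of a set `T` of primes. -/
noncomputable def logSum (T : Set ℕ) (x : ℝ) : ℝ :=
  ∑ p ∈ (Finset.Icc 1 ⌊x⌋₊).filter (fun p => p ∈ T), Real.log (p : ℝ) / (p : ℝ)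

end AdditiveDecomposition

namespace AdditiveDecomposition

/-! Suppose `Q T` agrees from some point on with `A + B + C`. Grouping two of the summands gives
three binary decompositions `C + (A + B)`, `A + (B + C)` and `B + (A + C)`. The heart of the matter
is that in a binary decomposition `C + D` with at least two elements in `C`, the set `D` has at most
`N ^ (3/5)` elements up to `N`, for every large `N` at which `Q T` is not too sparse. The three pair
sums then all have this size, and the inequality `|A+B+C|² ≤ |A+B| |B+C| |A+C|`, in the truncated
form `card_triple_sum_sq_le`, bounds `Q T` up to `N` by about `N ^ (9/10)`. But `Q T` has more than
`N / (log N) ^ s` elements for arbitrarily large `N`, for any `s` between `1 - τ` and `1`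
(`frequently_card_Q_ge`).

The binary bound is a bootstrap on sieves. If `p ∉ T` is prime and `c ∈ C`, then large elements of
`D` avoid the class of `-c` modulo `p`. The primes outside `T` have logarithmic density `1 - τ`, so
`k` fixed elements of `C` and the large sieve give `D` at most `N / (log N) ^ s` elements, for each
`s < k (1 - τ)` (`eventually_card_summand_le`). With `k ≥ 2` this rules out a finite `C`
(`summand_infinite`); hence `k` is arbitrary, `D` is thinner than any power of `log N` allows, and
`C` must have at least `(log N) ^ 30` elements up to `N`.

By Gallagher's larger sieve so many elements occupy a proportion `≫ 1 / log N` of the classes modulo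
many primes `p ≤ (log N) ^ 30` outside `T`. Feeding products of these primes into the large sieve
gives a saving by a power of `N` (`card_filter_le_of_many_primes`). -/

/-! ### A sumset inequality for three summands -/

/-- The fibre over a first coordinate `a` has size at most `|Y|` and at most `x a * z a`, hence at
most the geometric mean of these two bounds. Summing over `a` and applying Cauchy–Schwarz to `√(x a)
* √(z a)` gives the result. -/
theorem loomis_whitney {α β γ : Type*} [DecidableEq α] [DecidableEq β] [DecidableEq γ]
    (R : Finset (α × β × γ)) :
    R.card ^ 2 ≤ (R.image fun t => (t.1, t.2.1)).card * (R.image fun t => (t.2.1, t.2.2)).card *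
      (R.image fun t => (t.1, t.2.2)).card := by
  classical
  set X := R.image fun t => (t.1, t.2.1) with hX
  set Y := R.image fun t => (t.2.1, t.2.2) with hY
  set Z := R.image fun t => (t.1, t.2.2) with hZ
  set A := R.image fun t => t.1 with hA
  let x : α → ℕ := fun a => (X.filter fun u => u.1 = a).card
  let z : α → ℕ := fun a => (Z.filter fun u => u.1 = a).card
  let f : α → ℕ := fun a => (R.filter fun u => u.1 = a).card
  have hR : R.card = ∑ a ∈ A, f a :=
    Finset.card_eq_sum_card_fiberwise fun t ht => Finset.mem_image_of_mem _ ht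
  have hXs : X.card = ∑ a ∈ A, x a := by
    refine Finset.card_eq_sum_card_fiberwise fun t ht => ?_
    obtain ⟨u, hu, rfl⟩ := Finset.mem_image.1 ht
    exact Finset.mem_image_of_mem _ hu
  have hZs : Z.card = ∑ a ∈ A, z a := by
    refine Finset.card_eq_sum_card_fiberwise fun t ht => ?_
    obtain ⟨u, hu, rfl⟩ := Finset.mem_image.1 ht
    exact Finset.mem_image_of_mem _ hu
  have h1 : ∀ a, f a ≤ Y.card := fun a => by
    refine Finset.card_le_card_of_injOn (fun t => (t.2.1, t.2.2)) (fun t ht => ?_) ?_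
    · exact Finset.mem_image_of_mem (fun t : α × β × γ => (t.2.1, t.2.2)) (Finset.mem_filter.1 ht).1
    · rintro ⟨a1, b1, c1⟩ h1 ⟨a2, b2, c2⟩ h2 h
      simp only [Finset.coe_filter, Set.mem_ofPred_eq, Prod.mk.injEq] at h1 h2 h ⊢
      exact ⟨h1.2.trans h2.2.symm, h⟩
  have h2 : ∀ a, f a ≤ x a * z a := fun a => by
    rw [← Finset.card_product]
    refine Finset.card_le_card_of_injOn (fun t => ((t.1, t.2.1), (t.1, t.2.2))) (fun t ht => ?_) ?_
    · have ht' := Finset.mem_filter.1 ht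
      simp only [Finset.coe_product, Set.mem_prod, Finset.mem_coe, Finset.mem_filter]
      exact ⟨⟨Finset.mem_image_of_mem (fun t : α × β × γ => (t.1, t.2.1)) ht'.1, ht'.2⟩,
        ⟨Finset.mem_image_of_mem (fun t : α × β × γ => (t.1, t.2.2)) ht'.1, ht'.2⟩⟩
    · rintro ⟨a1, b1, c1⟩ h1 ⟨a2, b2, c2⟩ h2 h
      simp only [Prod.mk.injEq] at h ⊢
      tauto
  have h3 : (R.card : ℝ) ≤ ∑ a ∈ A, √(Y.card : ℝ) * (√(x a : ℝ) * √(z a : ℝ)) := by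
    rw [hR]; push_cast
    refine Finset.sum_le_sum fun a _ => ?_
    rw [← Real.sqrt_mul (by positivity), ← Real.sqrt_mul (by positivity)]
    refine Real.le_sqrt_of_sq_le ?_
    have h1' : (f a : ℝ) ≤ Y.card := by exact_mod_cast h1 a
    have h2' : (f a : ℝ) ≤ x a * z a := by exact_mod_cast h2 a
    rw [sq]
    exact mul_le_mul h1' h2' (by positivity) (by positivity)
  have h4 : (∑ a ∈ A, √(x a : ℝ) * √(z a : ℝ)) ^ 2 ≤ X.card * Z.card := by
    refine (Finset.sum_mul_sq_le_sq_mul_sq A _ _).trans ?_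
    rw [hXs, hZs]; push_cast
    simp [Real.sq_sqrt]
  rw [← Finset.mul_sum] at h3
  have h5 : (R.card : ℝ) ^ 2 ≤ X.card * Y.card * Z.card := by
    calc (R.card : ℝ) ^ 2 ≤ (√(Y.card : ℝ) * ∑ a ∈ A, √(x a : ℝ) * √(z a : ℝ)) ^ 2 := by gcongr
      _ = Y.card * (∑ a ∈ A, √(x a : ℝ) * √(z a : ℝ)) ^ 2 := by
        rw [mul_pow, Real.sq_sqrt (by positivity)]
      _ ≤ Y.card * (X.card * Z.card) := by gcongr
      _ = _ := by ring
  exact_mod_cast h5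

/-- The Gyarmati–Matolcsi–Ruzsa inequality for a set of sums of three summands. -/
theorem card_triple_sum_sq_le {A B C : Set ℕ} {E X Y Z : Finset ℕ}
    (hE : ∀ s ∈ E, ∃ a ∈ A, ∃ b ∈ B, ∃ c ∈ C, a + b + c = s)
    (hXYZ : ∀ a ∈ A, ∀ b ∈ B, ∀ c ∈ C, a + b + c ∈ E → a + b ∈ X ∧ b + c ∈ Y ∧ a + c ∈ Z) :
    E.card ^ 2 ≤ X.card * Y.card * Z.card := by
  classical
  -- Each sum is represented by its lexicographically least triple. Minimality makes each coordinate
  -- projection of a chosen triple recoverable from the sum of the two coordinates, so projections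
  -- can be counted by pair sums.
  have hrep : ∀ s ∈ E, ∃ t : ℕ × ℕ × ℕ, (t.1 ∈ A ∧ t.2.1 ∈ B ∧ t.2.2 ∈ C ∧
      t.1 + t.2.1 + t.2.2 = s) ∧ (∀ a ∈ A, ∀ b ∈ B, ∀ c ∈ C, a + b + c = s →
        t.1 ≤ a ∧ (a = t.1 → t.2.1 ≤ b)) := by
    intro s hs
    have hex : ∃ a, a ∈ A ∧ ∃ b ∈ B, ∃ c ∈ C, a + b + c = s := by
      obtain ⟨a, ha, h⟩ := hE s hs
      exact ⟨a, ha, h⟩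
    have hex2 : ∃ b, b ∈ B ∧ ∃ c ∈ C, Nat.find hex + b + c = s := by
      obtain ⟨-, b, hb, h⟩ := Nat.find_spec hex
      exact ⟨b, hb, h⟩
    obtain ⟨hb, c, hc, hsum⟩ := Nat.find_spec hex2
    refine ⟨(Nat.find hex, Nat.find hex2, c), ⟨(Nat.find_spec hex).1, hb, hc, hsum⟩, ?_⟩
    intro a ha b hb c hc h
    refine ⟨Nat.find_min' hex ⟨ha, b, hb, c, hc, h⟩, ?_⟩
    rintro rfl
    exact Nat.find_min' hex2 ⟨hb, c, hc, h⟩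
  choose! t ht hmin using hrep
  set R := E.image t
  have hcard : R.card = E.card := by
    refine Finset.card_image_of_injOn fun s hs s' hs' h => ?_
    rw [← (ht s hs).2.2.2, ← (ht s' hs').2.2.2, h]
  rw [← hcard]
  have hmem : ∀ s ∈ E, (t s).1 + (t s).2.1 ∈ X ∧ (t s).2.1 + (t s).2.2 ∈ Y ∧
      (t s).1 + (t s).2.2 ∈ Z := fun s hs =>
    hXYZ _ (ht s hs).1 _ (ht s hs).2.1 _ (ht s hs).2.2.1 (by rw [(ht s hs).2.2.2]; exact hs)
  have key : ∀ f : ℕ × ℕ × ℕ → ℕ × ℕ, ∀ U : Finset ℕ,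
      (∀ s ∈ E, (f (t s)).1 + (f (t s)).2 ∈ U) →
      (∀ s ∈ E, ∀ s' ∈ E, (f (t s)).1 + (f (t s)).2 = (f (t s')).1 + (f (t s')).2 →
        f (t s) = f (t s')) → (R.image f).card ≤ U.card := by
    intro f U h1 h2
    refine Finset.card_le_card_of_injOn (fun u => u.1 + u.2) ?_ ?_
    · intro u hu
      obtain ⟨r, hr, rfl⟩ := Finset.mem_image.1 hu
      obtain ⟨s, hs, rfl⟩ := Finset.mem_image.1 hr
      exact h1 s hs
    · intro u hu v hv h
      obtain ⟨r, hr, rfl⟩ := Finset.mem_image.1 hu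
      obtain ⟨s, hs, rfl⟩ := Finset.mem_image.1 hr
      obtain ⟨r, hr, rfl⟩ := Finset.mem_image.1 hv
      obtain ⟨s', hs', rfl⟩ := Finset.mem_image.1 hr
      exact h2 s hs s' hs' h
  refine (loomis_whitney R).trans ?_
  gcongr
  -- Exchange: two chosen triples with equal pair sums may swap those pairs and still represent the
  -- same totals, so minimality applies in both directions.
  · refine key _ _ (fun s hs => (hmem s hs).1) fun s hs s' hs' h => ?_
    have e1 := ht s hs
    have e2 := ht s' hs'
    have m1 := hmin s hs (t s').1 e2.1 (t s').2.1 e2.2.1 (t s).2.2 e1.2.2.1 (by omega)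
    have m2 := hmin s' hs' (t s).1 e1.1 (t s).2.1 e1.2.1 (t s').2.2 e2.2.2.1 (by omega)
    ext <;> simp only at h ⊢ <;> omega
  · refine key _ _ (fun s hs => (hmem s hs).2.1) fun s hs s' hs' h => ?_
    have e1 := ht s hs
    have e2 := ht s' hs'
    have m1 := (hmin s hs (t s).1 e1.1 (t s').2.1 e2.2.1 (t s').2.2 e2.2.2.1 (by omega)).2 rfl
    have m2 := (hmin s' hs' (t s').1 e2.1 (t s).2.1 e1.2.1 (t s).2.2 e1.2.2.1 (by omega)).2 rfl
    ext <;> simp only at h ⊢ <;> omega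
  · refine key _ _ (fun s hs => (hmem s hs).2.2) fun s hs s' hs' h => ?_
    have e1 := ht s hs
    have e2 := ht s' hs'
    have m1 := hmin s hs (t s').1 e2.1 (t s).2.1 e1.2.1 (t s').2.2 e2.2.2.1 (by omega)
    have m2 := hmin s' hs' (t s).1 e1.1 (t s').2.1 e2.2.1 (t s).2.2 e1.2.2.1 (by omega)
    ext <;> simp only at h ⊢ <;> omega

/-! ### Sums of periodic functions -/

/-- By the Chinese remainder theorem, `n ↦ (n % R, n % p)` is a bijection onto pairs of residues. -/
theorem sum_range_mul_of_periodic {R p : ℕ} (hR : 0 < R) (hp : 0 < p) (hco : R.Coprime p)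
    {F h : ℕ → ℝ} (hF : Function.Periodic F R) (hh : Function.Periodic h p) :
    ∑ n ∈ Finset.range (R * p), F n * h n =
      (∑ n ∈ Finset.range R, F n) * ∑ n ∈ Finset.range p, h n := by
  rw [Finset.sum_mul_sum, ← Finset.sum_product']
  refine Finset.sum_nbij' (fun n => (n % R, n % p))
    (fun u => (Nat.chineseRemainder hco u.1 u.2 : ℕ)) ?_ ?_ ?_ ?_ ?_
  · intro n _
    simp [Nat.mod_lt _ hR, Nat.mod_lt _ hp]
  · intro u _
    exact Finset.mem_range.2 (Nat.chineseRemainder_lt_mul hco u.1 u.2 hR.ne' hp.ne')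
  · intro n hn
    have h1 := (Nat.chineseRemainder hco (n % R) (n % p)).2
    have h2 : (Nat.chineseRemainder hco (n % R) (n % p) : ℕ) ≡ n [MOD R * p] :=
      (Nat.modEq_and_modEq_iff_modEq_mul hco).1
        ⟨h1.1.trans (Nat.mod_modEq n R), h1.2.trans (Nat.mod_modEq n p)⟩
    exact Nat.ModEq.eq_of_lt_of_lt h2
      (Nat.chineseRemainder_lt_mul hco _ _ hR.ne' hp.ne') (Finset.mem_range.1 hn)
  · rintro ⟨a, b⟩ hu
    simp only [Finset.mem_product, Finset.mem_range] at hu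
    have h1 := (Nat.chineseRemainder hco a b).2
    have e1 : (Nat.chineseRemainder hco a b : ℕ) % R = a := by
      rw [h1.1, Nat.mod_eq_of_lt hu.1]
    have e2 : (Nat.chineseRemainder hco a b : ℕ) % p = b := by
      rw [h1.2, Nat.mod_eq_of_lt hu.2]
    simp [e1, e2]
  · intro n _
    rw [hF.map_mod_nat, hh.map_mod_nat]

theorem periodic_prod_primes {PP : Finset ℕ} {h : ℕ → ℕ → ℝ}
    (hh : ∀ p ∈ PP, Function.Periodic (h p) p) {R : ℕ} (hR : ∀ p ∈ PP, p ∣ R) :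
    Function.Periodic (fun n => ∏ p ∈ PP, h p n) R := by
  intro n
  refine Finset.prod_congr rfl fun p hp => ?_
  obtain ⟨k, rfl⟩ := hR p hp
  have := (hh p hp).nat_mul k n
  simpa [mul_comm] using this

theorem sum_range_prod_of_periodic {PP : Finset ℕ} (hPP : ∀ p ∈ PP, p.Prime) {h : ℕ → ℕ → ℝ}
    (hh : ∀ p ∈ PP, Function.Periodic (h p) p) :
    ∑ n ∈ Finset.range (∏ p ∈ PP, p), ∏ p ∈ PP, h p n =
      ∏ p ∈ PP, ∑ n ∈ Finset.range p, h p n := by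
  classical
  induction PP using Finset.induction_on with
  | empty => simp
  | insert q s hq ih =>
    have hs : ∀ p ∈ s, p.Prime := fun p hp => hPP p (Finset.mem_insert_of_mem hp)
    have hqp := hPP q (Finset.mem_insert_self q s)
    have hco : Nat.Coprime (∏ p ∈ s, p) q := by
      refine Nat.Coprime.prod_left fun p hp => ?_
      refine (Nat.coprime_primes (hs p hp) hqp).2 ?_
      rintro rfl
      exact hq hp
    simp only [Finset.prod_insert hq]
    rw [← ih hs fun p hp => hh p (Finset.mem_insert_of_mem hp), mul_comm q,
      mul_comm (∑ n ∈ Finset.range q, h q n),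
      ← sum_range_mul_of_periodic (Finset.prod_pos fun p hp => (hs p hp).pos) hqp.pos hco
        (periodic_prod_primes (fun p hp => hh p (Finset.mem_insert_of_mem hp))
          fun p hp => Finset.dvd_prod_of_mem _ hp) (hh q (Finset.mem_insert_self q s))]
    exact Finset.sum_congr rfl fun n _ => mul_comm _ _

theorem sum_range_add_of_periodic {E : Type*} [AddCommGroup E] {M : ℕ} {F : ℕ → E}
    (hF : Function.Periodic F M) (R : ℕ) :
    ∑ n ∈ Finset.range M, F (n + R) = ∑ n ∈ Finset.range M, F n := by
  induction R with
  | zero => rfl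
  | succ R ih =>
    rw [← ih]
    have h1 := Finset.sum_range_succ (fun n => F (n + R)) M
    have h2 := Finset.sum_range_succ' (fun n => F (n + R)) M
    have h3 : F (M + R) = F (0 + R) := by
      rw [add_comm M, zero_add]; exact hF R
    rw [h1, h3] at h2
    have h4 := add_right_cancel h2
    rw [h4]
    exact Finset.sum_congr rfl fun n _ => by congr 1; ring

theorem sum_range_mul_period {P : ℕ} {F : ℕ → ℝ} (hF : Function.Periodic F P) (Z : ℕ) :
    ∑ n ∈ Finset.range (P * Z), F n = Z * ∑ n ∈ Finset.range P, F n := by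
  induction Z with
  | zero => simp
  | succ Z ih =>
    rw [Nat.mul_succ, Finset.sum_range_add, ih]
    have : ∀ n, F (P * Z + n) = F n := fun n => by
      have := hF.nat_mul Z n
      rw [add_comm, mul_comm]; simpa using this
    simp only [this]
    push_cast; ring

/-- The shift `n ↦ n + R` leaves the sum over a full period unchanged but multiplies it by `z ^ R ≠
1`. -/
theorem sum_pow_mul_periodic_eq_zero {M R : ℕ} (hRM : R ∣ M) {z : ℂ} (hz : z ^ M = 1)
    (hzR : z ^ R ≠ 1) {F : ℕ → ℂ} (hF : Function.Periodic F R) :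
    ∑ n ∈ Finset.range M, z ^ n * F n = 0 := by
  have hFM : Function.Periodic F M := by
    obtain ⟨k, rfl⟩ := hRM
    have := hF.nat_mul k
    simpa [mul_comm] using this
  have hper : Function.Periodic (fun n => z ^ n * F n) M := fun n => by
    simp [pow_add, hz, hFM n]
  have h1 := sum_range_add_of_periodic hper R
  have h2 : ∑ n ∈ Finset.range M, z ^ (n + R) * F (n + R) =
      z ^ R * ∑ n ∈ Finset.range M, z ^ n * F n := by
    rw [Finset.mul_sum]
    refine Finset.sum_congr rfl fun n _ => ?_
    rw [hF n, pow_add]; ring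
  rw [h2] at h1
  have h3 : (z ^ R - 1) * ∑ n ∈ Finset.range M, z ^ n * F n = 0 := by
    rw [sub_mul, h1]; ring
  exact (mul_eq_zero.1 h3).resolve_left (sub_ne_zero.2 hzR)

/-! ### The large sieve -/

/-- The indicator function of the residue classes `r` modulo `p`, minus its mean. -/
noncomputable def centred (r : ℕ → Finset ℕ) (p n : ℕ) : ℝ :=
  (if n % p ∈ r p then 1 else 0) - (r p).card / p

theorem centred_periodic (r : ℕ → Finset ℕ) (p : ℕ) : Function.Periodic (centred r p) p := by
  intro n
  simp [centred]

theorem sum_centred {r : ℕ → Finset ℕ} {p : ℕ} (hp : 0 < p) (hr : r p ⊆ Finset.range p) :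
    ∑ n ∈ Finset.range p, centred r p n = 0 := by
  have h0 : (p : ℝ) ≠ 0 := by positivity
  have h1 : ∑ n ∈ Finset.range p, (if n % p ∈ r p then (1 : ℝ) else 0) = (r p).card := by
    rw [Finset.sum_congr rfl fun n hn => by rw [Nat.mod_eq_of_lt (Finset.mem_range.1 hn)]]
    rw [Finset.sum_ite_mem, Finset.inter_eq_right.2 hr]
    simp
  simp only [centred, Finset.sum_sub_distrib, h1]
  simp
  field_simp
  ring

theorem sum_centred_sq {r : ℕ → Finset ℕ} {p : ℕ} (hp : 0 < p) (hr : r p ⊆ Finset.range p) :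
    ∑ n ∈ Finset.range p, centred r p n ^ 2 =
      p * (((r p).card / p : ℝ) * (1 - (r p).card / p)) := by
  have h0 : (p : ℝ) ≠ 0 := by positivity
  have h1 : ∑ n ∈ Finset.range p, (if n % p ∈ r p then (1 : ℝ) else 0) = (r p).card := by
    rw [Finset.sum_congr rfl fun n hn => by rw [Nat.mod_eq_of_lt (Finset.mem_range.1 hn)]]
    rw [Finset.sum_ite_mem, Finset.inter_eq_right.2 hr]
    simp
  have h2 : ∀ n, centred r p n ^ 2 = (if n % p ∈ r p then (1 : ℝ) else 0) *
      (1 - 2 * ((r p).card / p)) + ((r p).card / p : ℝ) ^ 2 := fun n => by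
    unfold centred
    split_ifs <;> ring
  simp only [h2, Finset.sum_add_distrib, ← Finset.sum_mul, h1]
  simp
  field_simp
  ring

/-- The sum factors over the primes of `PP`. A prime in exactly one of `S`, `S'` contributes the sum
of a centred function, which is zero; a prime in both contributes `p` times a variance. -/
theorem sum_prod_centred_mul {PP : Finset ℕ} (hPP : ∀ p ∈ PP, p.Prime) {r : ℕ → Finset ℕ}
    (hr : ∀ p ∈ PP, r p ⊆ Finset.range p) {S S' : Finset ℕ} (hS : S ⊆ PP) (hS' : S' ⊆ PP) :
    ∑ n ∈ Finset.range (∏ p ∈ PP, p), (∏ p ∈ S, centred r p n) * ∏ p ∈ S', centred r p n =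
      if S = S' then (∏ p ∈ PP, (p : ℝ)) *
        ∏ p ∈ S, (((r p).card / p : ℝ) * (1 - (r p).card / p)) else 0 := by
  classical
  have hpr : ∀ U ⊆ PP, ∀ f : ℕ → ℝ,
      ∏ p ∈ U, f p = ∏ p ∈ PP, if p ∈ U then f p else 1 := fun U hU f => by
    rw [Finset.prod_ite_mem, Finset.inter_eq_right.2 hU]
  have h1 : ∀ n, (∏ p ∈ S, centred r p n) * ∏ p ∈ S', centred r p n =
      ∏ p ∈ PP, ((if p ∈ S then centred r p n else 1) *
        (if p ∈ S' then centred r p n else 1)) := fun n => by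
    rw [hpr S hS, hpr S' hS', Finset.prod_mul_distrib]
  simp only [h1]
  rw [sum_range_prod_of_periodic (h := fun p n => (if p ∈ S then centred r p n else 1) *
        (if p ∈ S' then centred r p n else 1)) hPP]
  · split_ifs with hSS
    · subst hSS
      rw [hpr S hS, ← Finset.prod_mul_distrib]
      refine Finset.prod_congr rfl fun p hp => ?_
      split_ifs with h
      · simp only [← sq]
        exact sum_centred_sq (hPP p hp).pos (hr p hp)
      · simp
    · obtain ⟨p, hp⟩ : ∃ p, ¬(p ∈ S ↔ p ∈ S') := by
        by_contra hcon
        push Not at hcon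
        exact hSS (Finset.ext hcon)
      have hpp : p ∈ PP := by
        by_cases h : p ∈ S
        · exact hS h
        · exact hS' (by tauto)
      refine Finset.prod_eq_zero hpp ?_
      by_cases h : p ∈ S
      · have h' : p ∉ S' := by tauto
        simpa [h, h'] using sum_centred (hPP p hpp).pos (hr p hpp)
      · have h' : p ∈ S' := by tauto
        simpa [h, h'] using sum_centred (hPP p hpp).pos (hr p hpp)
  · intro p _ n
    simp only [centred_periodic r p n]

/-- A linear combination of products of centred indicator functions. -/
noncomputable def sieveSum (r : ℕ → Finset ℕ) (Fam : Finset (Finset ℕ)) (t : Finset ℕ → ℝ)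
    (n : ℕ) : ℝ :=
  ∑ S ∈ Fam, t S * ∏ p ∈ S, centred r p n

theorem sum_sieveSum_sq {PP : Finset ℕ} (hPP : ∀ p ∈ PP, p.Prime) {r : ℕ → Finset ℕ}
    (hr : ∀ p ∈ PP, r p ⊆ Finset.range p) {Fam : Finset (Finset ℕ)} (hFam : ∀ S ∈ Fam, S ⊆ PP)
    (t : Finset ℕ → ℝ) :
    ∑ n ∈ Finset.range (∏ p ∈ PP, p), sieveSum r Fam t n ^ 2 = (∏ p ∈ PP, (p : ℝ)) *
      ∑ S ∈ Fam, t S ^ 2 * ∏ p ∈ S, (((r p).card / p : ℝ) * (1 - (r p).card / p)) := by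
  have h1 : ∀ n, sieveSum r Fam t n ^ 2 = ∑ S ∈ Fam, ∑ S' ∈ Fam, t S * t S' *
      ((∏ p ∈ S, centred r p n) * ∏ p ∈ S', centred r p n) := fun n => by
    rw [sieveSum, sq, Finset.sum_mul_sum]
    exact Finset.sum_congr rfl fun S _ => Finset.sum_congr rfl fun S' _ => by ring
  simp only [h1]
  rw [Finset.sum_comm, Finset.mul_sum]
  refine Finset.sum_congr rfl fun S hS => ?_
  rw [Finset.sum_comm]
  have h2 : ∀ S' ∈ Fam, ∑ n ∈ Finset.range (∏ p ∈ PP, p), t S * t S' *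
      ((∏ p ∈ S, centred r p n) * ∏ p ∈ S', centred r p n) =
      if S = S' then t S * t S' * ((∏ p ∈ PP, (p : ℝ)) *
        ∏ p ∈ S, (((r p).card / p : ℝ) * (1 - (r p).card / p))) else 0 := fun S' hS' => by
    rw [← Finset.mul_sum, sum_prod_centred_mul hPP hr (hFam S hS) (hFam S' hS')]
    split_ifs <;> simp
  rw [Finset.sum_congr rfl h2, Finset.sum_ite_eq, if_pos hS]
  ring

theorem periodic_sieveSum {PP : Finset ℕ} {r : ℕ → Finset ℕ} {Fam : Finset (Finset ℕ)}
    (hFam : ∀ S ∈ Fam, S ⊆ PP) (t : Finset ℕ → ℝ) :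
    Function.Periodic (sieveSum r Fam t) (∏ p ∈ PP, p) := by
  intro n
  refine Finset.sum_congr rfl fun S hS => ?_
  have := periodic_prod_primes (PP := S) (h := centred r) (R := ∏ p ∈ PP, p)
    (fun p _ => centred_periodic r p) (fun p hp => Finset.dvd_prod_of_mem _ (hFam S hS hp)) n
  simp only at this
  rw [this]

/-- The Dirichlet kernel with `H` terms built from the root of unity `ζ`. -/
noncomputable def dirichletKernel (ζ : ℂ) (H n : ℕ) : ℂ := ∑ j ∈ Finset.range H, ζ ^ (j * n)

theorem dirichletKernel_mul_conj (ζ : ℂ) (H n : ℕ) :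
    ((‖dirichletKernel ζ H n‖ ^ 2 : ℝ) : ℂ) = ∑ i ∈ Finset.range H, ∑ j ∈ Finset.range H,
      (ζ ^ i * (starRingEnd ℂ) ζ ^ j) ^ n := by
  have := Complex.mul_conj' (dirichletKernel ζ H n)
  push_cast
  rw [← this, dirichletKernel, map_sum, Finset.sum_mul_sum]
  refine Finset.sum_congr rfl fun i _ => Finset.sum_congr rfl fun j _ => ?_
  rw [map_pow, mul_pow, ← pow_mul, ← pow_mul]

/-- The product of centred functions has period `R = ∏ p ∈ S ∪ S', p ≤ 6 * N`, while the oscillation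
has frequency `(i - j) / M` with `|i - j| < P`, where `P = ∏ p ∈ PP, p`. Since `|i - j| * R < P * (6
* N) = M`, the frequency is not a multiple of `1 / R`. -/
theorem sum_kernel_mul_prod_eq_zero {PP : Finset ℕ} (hPP : ∀ p ∈ PP, p.Prime) {r : ℕ → Finset ℕ}
    {N : ℕ} (hN : 1 ≤ N) {S S' : Finset ℕ} (hS : S ⊆ PP) (hS' : S' ⊆ PP)
    (hSN : (∏ p ∈ S, p) ^ 2 ≤ 6 * N) (hSN' : (∏ p ∈ S', p) ^ 2 ≤ 6 * N) {ζ : ℂ}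
    (hprim : IsPrimitiveRoot ζ ((∏ p ∈ PP, p) * (6 * N))) (hζ : ζ * (starRingEnd ℂ) ζ = 1)
    {i j : ℕ} (hi : i < ∏ p ∈ PP, p) (hj : j < ∏ p ∈ PP, p) (hij : i ≠ j) :
    ∑ n ∈ Finset.range ((∏ p ∈ PP, p) * (6 * N)), (ζ ^ i * (starRingEnd ℂ) ζ ^ j) ^ n *
      (((∏ p ∈ S, centred r p n) * ∏ p ∈ S', centred r p n : ℝ) : ℂ) = 0 := by
  classical
  set M := (∏ p ∈ PP, p) * (6 * N) with hM
  set R := ∏ p ∈ S ∪ S', p with hR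
  have hU : S ∪ S' ⊆ PP := Finset.union_subset hS hS'
  have hpos : ∀ U ⊆ PP, 0 < ∏ p ∈ U, p := fun U hU =>
    Finset.prod_pos fun p hp => (hPP p (hU hp)).pos
  have hRle : R ≤ 6 * N := by
    have h1 : R * ∏ p ∈ S ∩ S', p = (∏ p ∈ S, p) * ∏ p ∈ S', p := Finset.prod_union_inter
    have h2 := hpos (S ∩ S') (Finset.inter_subset_left.trans hS)
    have h3 : R ≤ (∏ p ∈ S, p) * ∏ p ∈ S', p := by
      rw [← h1]; exact Nat.le_mul_of_pos_right _ h2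
    -- Uses `2 * a * b ≤ a ^ 2 + b ^ 2` for the two products.
    nlinarith [sq_nonneg (((∏ p ∈ S, p : ℕ) : ℤ) - ((∏ p ∈ S', p : ℕ) : ℤ))]
  have hRpos : 0 < R := hpos _ hU
  have hRM : R ∣ M := Dvd.dvd.mul_right (Finset.prod_dvd_prod_of_subset _ _ _ hU) _
  have hconj : (starRingEnd ℂ) ζ ^ M = 1 := by
    rw [← map_pow, hprim.pow_eq_one, map_one]
  refine sum_pow_mul_periodic_eq_zero hRM ?_ ?_ ?_
  · rw [mul_pow, ← pow_mul, ← pow_mul, mul_comm i, mul_comm j, pow_mul ζ M,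
      pow_mul _ M, hconj,
      hprim.pow_eq_one]
    simp
  · intro h
    have h1 : ζ ^ (i * R) = ζ ^ (j * R) := by
      have h2 : (ζ ^ i * (starRingEnd ℂ) ζ ^ j) ^ R * ζ ^ (j * R) = ζ ^ (i * R) := by
        calc (ζ ^ i * (starRingEnd ℂ) ζ ^ j) ^ R * ζ ^ (j * R)
            = ζ ^ (i * R) * (ζ * (starRingEnd ℂ) ζ) ^ (j * R) := by
              rw [mul_pow, mul_pow, ← pow_mul, ← pow_mul]; ring
          _ = _ := by rw [hζ]; simp
      rw [← h2, h, one_mul]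
    have hlt : ∀ k < ∏ p ∈ PP, p, k * R < M := fun k hk =>
      calc k * R < (∏ p ∈ PP, p) * R := Nat.mul_lt_mul_of_pos_right hk hRpos
        _ ≤ M := Nat.mul_le_mul_left _ hRle
    exact hij (Nat.eq_of_mul_eq_mul_right hRpos (hprim.pow_inj (hlt i hi) (hlt j hj) h1))
  · intro n
    have h1 := periodic_prod_primes (PP := S) (h := centred r) (R := R)
      (fun p _ => centred_periodic r p)
      (fun p hp => Finset.dvd_prod_of_mem _ (Finset.mem_union_left _ hp)) n
    have h2 := periodic_prod_primes (PP := S') (h := centred r) (R := R)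
      (fun p _ => centred_periodic r p)
      (fun p hp => Finset.dvd_prod_of_mem _ (Finset.mem_union_right _ hp)) n
    simp only at h1 h2 ⊢
    rw [h1, h2]

/-- For `j < P` and `n ≤ N` each phase `2 * π * j * n / (6 * N * P)` is at most `π / 3`, so every
term has real part at least `1 / 2`. This is the reason for the factor `6`. -/
theorem half_le_norm_dirichletKernel {P N n : ℕ} (hP : 0 < P) (hN : 1 ≤ N) (hn : n ≤ N) :
    (P / 2 : ℝ) ≤
      ‖dirichletKernel (Complex.exp (2 * Real.pi * Complex.I / (P * (6 * N) : ℕ))) P n‖ := by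
  refine le_trans ?_ (Complex.re_le_norm _)
  rw [dirichletKernel, Complex.re_sum]
  have : (P / 2 : ℝ) = ∑ _j ∈ Finset.range P, (1 / 2 : ℝ) := by simp; ring
  rw [this]
  refine Finset.sum_le_sum fun j hj => ?_
  have hj' : (j : ℝ) ≤ P := by exact_mod_cast (Finset.mem_range.1 hj).le
  have hn' : (n : ℝ) ≤ N := by exact_mod_cast hn
  have hPr : (0 : ℝ) < P := by exact_mod_cast hP
  have hNr : (0 : ℝ) < N := by exact_mod_cast hN
  rw [← Complex.exp_nat_mul]
  have h1 : ((j * n : ℕ) : ℂ) * (2 * Real.pi * Complex.I / (P * (6 * N) : ℕ)) =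
      ((j * n * (2 * Real.pi / (P * (6 * N))) : ℝ) : ℂ) * Complex.I := by
    push_cast; ring
  rw [h1, Complex.exp_ofReal_mul_I_re, ← Real.cos_pi_div_three]
  have h2 : (j : ℝ) * n * (2 * Real.pi / (P * (6 * N))) ≤ Real.pi / 3 := by
    calc (j : ℝ) * n * (2 * Real.pi / (P * (6 * N)))
        ≤ P * N * (2 * Real.pi / (P * (6 * N))) := by
          have := Real.pi_pos
          gcongr
      _ = Real.pi / 3 := by field_simp; ring
  refine Real.cos_le_cos_of_nonneg_of_le_pi (by have := Real.pi_pos; positivity) ?_ h2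
  linarith [Real.pi_pos]

/-- Expanding the squared kernel over pairs `(i, j)`, only the diagonal survives: against `sieveSum
^ 2` the kernel acts like its mean `P`, although it is concentrated on `n ≤ N`. -/
theorem sum_kernel_sieveSum_sq {PP : Finset ℕ} (hPP : ∀ p ∈ PP, p.Prime) {r : ℕ → Finset ℕ}
    {N : ℕ} (hN : 1 ≤ N) {Fam : Finset (Finset ℕ)}
    (hFam : ∀ S ∈ Fam, S ⊆ PP ∧ (∏ p ∈ S, p) ^ 2 ≤ 6 * N) (t : Finset ℕ → ℝ) {ζ : ℂ}
    (hprim : IsPrimitiveRoot ζ ((∏ p ∈ PP, p) * (6 * N))) (hζ : ζ * (starRingEnd ℂ) ζ = 1) :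
    ∑ n ∈ Finset.range ((∏ p ∈ PP, p) * (6 * N)),
      ‖dirichletKernel ζ (∏ p ∈ PP, p) n‖ ^ 2 * sieveSum r Fam t n ^ 2 =
    (∏ p ∈ PP, (p : ℝ)) *
      ∑ n ∈ Finset.range ((∏ p ∈ PP, p) * (6 * N)), sieveSum r Fam t n ^ 2 := by
  set P := ∏ p ∈ PP, p with hP
  have hPr : (∏ p ∈ PP, (p : ℝ)) = P := by rw [hP]; push_cast; rfl
  rw [hPr]
  have h0 : ∀ n, ((sieveSum r Fam t n ^ 2 : ℝ) : ℂ) = ∑ S ∈ Fam, ∑ S' ∈ Fam, (t S * t S' : ℝ) *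
      (((∏ p ∈ S, centred r p n) * ∏ p ∈ S', centred r p n : ℝ) : ℂ) := fun n => by
    rw [sieveSum, sq, Finset.sum_mul_sum]
    push_cast
    exact Finset.sum_congr rfl fun S _ => Finset.sum_congr rfl fun S' _ => by ring
  have h1 : ∀ i ∈ Finset.range P, ∀ j ∈ Finset.range P,
      ∑ n ∈ Finset.range (P * (6 * N)), (ζ ^ i * (starRingEnd ℂ) ζ ^ j) ^ n *
        ((sieveSum r Fam t n ^ 2 : ℝ) : ℂ) =
      if i = j then ((∑ n ∈ Finset.range (P * (6 * N)), sieveSum r Fam t n ^ 2 : ℝ) : ℂ)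
        else 0 := by
    intro i hi j hj
    split_ifs with hij
    · subst hij
      rw [← mul_pow, hζ]
      push_cast
      simp
    · simp only [h0, Finset.mul_sum]
      rw [Finset.sum_comm]
      refine Finset.sum_eq_zero fun S hS => ?_
      rw [Finset.sum_comm]
      refine Finset.sum_eq_zero fun S' hS' => ?_
      have := sum_kernel_mul_prod_eq_zero (r := r) hPP hN (hFam S hS).1 (hFam S' hS').1
        (hFam S hS).2 (hFam S' hS').2 hprim hζ (Finset.mem_range.1 hi) (Finset.mem_range.1 hj) hij
      rw [← mul_zero ((t S * t S' : ℝ) : ℂ), ← this, Finset.mul_sum]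
      exact Finset.sum_congr rfl fun n _ => by ring
  have h2 : ((∑ n ∈ Finset.range (P * (6 * N)),
      ‖dirichletKernel ζ P n‖ ^ 2 * sieveSum r Fam t n ^ 2 : ℝ) : ℂ) =
      ((P * ∑ n ∈ Finset.range (P * (6 * N)), sieveSum r Fam t n ^ 2 : ℝ) : ℂ) := by
    rw [Complex.ofReal_sum]
    simp only [Complex.ofReal_mul, dirichletKernel_mul_conj ζ, Finset.sum_mul]
    rw [Finset.sum_comm]
    have h3 : ∀ i ∈ Finset.range P, ∑ n ∈ Finset.range (P * (6 * N)), ∑ j ∈ Finset.range P,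
        (ζ ^ i * (starRingEnd ℂ) ζ ^ j) ^ n * ((sieveSum r Fam t n ^ 2 : ℝ) : ℂ) =
        ((∑ n ∈ Finset.range (P * (6 * N)), sieveSum r Fam t n ^ 2 : ℝ) : ℂ) := by
      intro i hi
      rw [Finset.sum_comm, Finset.sum_congr rfl (h1 i hi), Finset.sum_ite_eq, if_pos hi]
    rw [Finset.sum_congr rfl h3, Finset.sum_const, Finset.card_range, nsmul_eq_mul]
    push_cast
    ring
  exact_mod_cast h2

/-- The arithmetic large sieve. -/
theorem large_sieve {PP : Finset ℕ} (hPP : ∀ p ∈ PP, p.Prime) {r : ℕ → Finset ℕ}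
    (hr : ∀ p ∈ PP, r p ⊆ Finset.range p) {N : ℕ} (hN : 1 ≤ N) {Fam : Finset (Finset ℕ)}
    (hFam : ∀ S ∈ Fam, S ⊆ PP ∧ (∏ p ∈ S, p) ^ 2 ≤ 6 * N) {X : Finset ℕ} (hXN : ∀ n ∈ X, n ≤ N)
    (hX : ∀ n ∈ X, ∀ p ∈ PP, n % p ∉ r p) :
    (X.card : ℝ) * ∑ S ∈ Fam, ∏ p ∈ S, ((r p).card / (p - (r p).card) : ℝ) ≤ 24 * N := by
  rcases X.eq_empty_or_nonempty with rfl | ⟨x0, hx0⟩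
  · simp
  have hNr : (1 : ℝ) ≤ N := by exact_mod_cast hN
  have hlt : ∀ p ∈ PP, ((r p).card : ℝ) < p := by
    intro p hp
    have h1 : (r p).card < (Finset.range p).card := by
      refine Finset.card_lt_card ⟨hr p hp, fun h => hX x0 hx0 p hp (h ?_)⟩
      exact Finset.mem_range.2 (Nat.mod_lt _ (hPP p hp).pos)
    rw [Finset.card_range] at h1
    exact_mod_cast h1
  set P := ∏ p ∈ PP, p with hP
  have hPpos : 0 < P := Finset.prod_pos fun p hp => (hPP p hp).pos
  have hPr : (∏ p ∈ PP, (p : ℝ)) = P := by rw [hP]; push_cast; rfl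
  have hPrpos : (0 : ℝ) < P := by exact_mod_cast hPpos
  set L := ∑ S ∈ Fam, ∏ p ∈ S, ((r p).card / (p - (r p).card) : ℝ) with hL
  -- On `X` every centred function equals `-(r p).card / p`. These weights make both the value of
  -- `sieveSum` on `X` and its mean square equal to `L`.
  let t : Finset ℕ → ℝ := fun S => ∏ p ∈ S, (-(1 / (1 - (r p).card / p)) : ℝ)
  have hppos : ∀ p ∈ PP, (0 : ℝ) < p := fun p hp => by exact_mod_cast (hPP p hp).pos
  have hG : ∀ n ∈ X, sieveSum r Fam t n = L := by
    intro n hn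
    refine Finset.sum_congr rfl fun S hS => ?_
    rw [← Finset.prod_mul_distrib]
    refine Finset.prod_congr rfl fun p hp => ?_
    have hp' := (hFam S hS).1 hp
    have h1 := hlt p hp'
    have h2 := hppos p hp'
    have h3 : (p : ℝ) - (r p).card ≠ 0 := by linarith
    simp only [centred, if_neg (hX n hn p hp')]
    field_simp
    ring
  have hvar : ∑ S ∈ Fam, t S ^ 2 *
      ∏ p ∈ S, (((r p).card / p : ℝ) * (1 - (r p).card / p)) = L := by
    refine Finset.sum_congr rfl fun S hS => ?_
    rw [← Finset.prod_pow, ← Finset.prod_mul_distrib]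
    refine Finset.prod_congr rfl fun p hp => ?_
    have hp' := (hFam S hS).1 hp
    have h1 := hlt p hp'
    have h2 := hppos p hp'
    have h3 : (p : ℝ) - (r p).card ≠ 0 := by linarith
    field_simp
  have hL0 : 0 ≤ L := by
    refine Finset.sum_nonneg fun S hS => Finset.prod_nonneg fun p hp => ?_
    have h1 := hlt p ((hFam S hS).1 hp)
    exact div_nonneg (by positivity) (by linarith)
  set ζ := Complex.exp (2 * Real.pi * Complex.I / (P * (6 * N) : ℕ)) with hζdef
  have hM0 : P * (6 * N) ≠ 0 := by positivity
  have hprim : IsPrimitiveRoot ζ (P * (6 * N)) := Complex.isPrimitiveRoot_exp _ hM0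
  have hζ : ζ * (starRingEnd ℂ) ζ = 1 := by
    rw [Complex.mul_conj', hprim.norm'_eq_one hM0]
    simp
  have h1 := sum_kernel_sieveSum_sq (r := r) hPP hN hFam t hprim hζ
  rw [sum_range_mul_period (F := fun n => sieveSum r Fam t n ^ 2)
    (fun n => by simp only [periodic_sieveSum (r := r) (fun S hS => (hFam S hS).1) t n]),
    sum_sieveSum_sq hPP hr (fun S hS => (hFam S hS).1), hvar, hPr] at h1
  have h2 : ∑ n ∈ X, (P / 2 : ℝ) ^ 2 * L ^ 2 ≤ ∑ n ∈ Finset.range (P * (6 * N)),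
      ‖dirichletKernel ζ P n‖ ^ 2 * sieveSum r Fam t n ^ 2 := by
    have hsub : X ⊆ Finset.range (P * (6 * N)) := by
      intro n hn
      have := hXN n hn
      rw [Finset.mem_range]
      nlinarith
    refine le_trans (Finset.sum_le_sum fun n hn => ?_)
      (Finset.sum_le_sum_of_subset_of_nonneg hsub fun n _ _ => mul_nonneg (sq_nonneg _) (sq_nonneg _))
    rw [hG n hn]
    exact mul_le_mul_of_nonneg_right (pow_le_pow_left₀ (half_pos hPrpos).le
      (half_le_norm_dirichletKernel hPpos hN (hXN n hn)) 2) (sq_nonneg _)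
  rw [h1, Finset.sum_const, nsmul_eq_mul] at h2
  push_cast at h2
  clear_value L P
  rcases hL0.eq_or_lt with h0 | h0
  · rw [← h0, mul_zero]
    exact mul_nonneg (by norm_num) (zero_le_one.trans hNr)
  -- The elements of `X` contribute at least `|X| * (P / 2) ^ 2 * L ^ 2` to a total of `P * (6 * N *
  -- P * L)`; cancelling `P ^ 2 * L` leaves `24 = 4 * 6`.
  · have h3 : (P : ℝ) ^ 2 * L * (X.card * L) ≤ (P : ℝ) ^ 2 * L * (24 * N) := by linarith
    exact le_of_mul_le_mul_left h3 (mul_pos (pow_pos hPrpos 2) h0)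

/-! ### Mertens estimates and partial summation -/

open Classical in
/-- The elements of `U` in the interval `[1, N]`. -/
noncomputable def upTo (U : Set ℕ) (N : ℕ) : Finset ℕ := (Finset.Icc 1 N).filter (· ∈ U)

theorem mem_upTo {U : Set ℕ} {N n : ℕ} : n ∈ upTo U N ↔ (1 ≤ n ∧ n ≤ N) ∧ n ∈ U := by
  simp [upTo]

theorem logSum_natCast (U : Set ℕ) (N : ℕ) :
    logSum U N = ∑ p ∈ upTo U N, Real.log p / p := by
  simp only [logSum, Nat.floor_natCast]
  rfl

theorem upTo_succ_sum (U : Set ℕ) (N : ℕ) (f : ℕ → ℝ) :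
    (N + 1 ∈ U ∧ ∑ p ∈ upTo U (N + 1), f p = ∑ p ∈ upTo U N, f p + f (N + 1)) ∨
    (N + 1 ∉ U ∧ ∑ p ∈ upTo U (N + 1), f p = ∑ p ∈ upTo U N, f p) := by
  classical
  have h : Finset.Icc 1 (N + 1) = insert (N + 1) (Finset.Icc 1 N) := by
    ext; simp; omega
  by_cases hU : N + 1 ∈ U
  · left
    refine ⟨hU, ?_⟩
    unfold upTo
    rw [h, Finset.filter_insert, if_pos hU, Finset.sum_insert (by simp), add_comm]
  · right
    refine ⟨hU, ?_⟩
    unfold upTo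
    rw [h, Finset.filter_insert, if_neg hU]

theorem log_factorial_eq (N : ℕ) : Real.log (N.factorial : ℝ) =
    ∑ p ∈ upTo {p | p.Prime} N, (N.factorial.factorization p : ℝ) * Real.log p := by
  rw [Real.log_nat_eq_sum_factorization]
  refine Finsupp.sum_of_support_subset _ ?_ _ (by simp)
  intro p hp
  rw [Nat.support_factorization, Nat.mem_primeFactors] at hp
  exact mem_upTo.2 ⟨⟨hp.1.one_le, (hp.1.dvd_factorial).1 hp.2.1⟩, hp.1⟩

theorem sum_log_primes_le (N : ℕ) : ∑ p ∈ upTo {p | p.Prime} N, Real.log p ≤ Real.log 4 * N := by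
  have h := Chebyshev.theta_le_log4_mul_x (x := (N : ℝ)) (by positivity)
  refine le_trans (le_of_eq ?_) h
  rw [Chebyshev.theta_eq_sum_Icc, Nat.floor_natCast]
  refine Finset.sum_congr ?_ fun _ _ => rfl
  ext p
  simp only [mem_upTo, Finset.mem_filter, Finset.mem_Icc, Set.mem_ofPred_eq]
  constructor
  · rintro ⟨⟨_, h2⟩, h3⟩; exact ⟨⟨by omega, h2⟩, h3⟩
  · rintro ⟨⟨_, h2⟩, h3⟩; exact ⟨⟨h3.one_le, h2⟩, h3⟩

/-- A prime `p` divides `N!` at least `⌊N / p⌋ > N / p - 1` times, and `log N! ≤ N log N`.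
Chebyshev's bound absorbs the loss of `log p` for each prime. -/
theorem logSum_primes_le {N : ℕ} (hN : 1 ≤ N) :
    logSum {p | p.Prime} N ≤ Real.log N + Real.log 4 := by
  have hNr : (0 : ℝ) < N := by exact_mod_cast hN
  have h1 : Real.log (N.factorial : ℝ) ≤ N * Real.log N := by
    rw [← Real.log_pow]
    refine Real.log_le_log (by exact_mod_cast N.factorial_pos) ?_
    exact_mod_cast N.factorial_le_pow
  rw [log_factorial_eq] at h1
  have h2 : ∀ p ∈ upTo {p | p.Prime} N, (N / p - 1 : ℝ) * Real.log p ≤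
      (N.factorial.factorization p : ℝ) * Real.log p := by
    intro p hp
    obtain ⟨⟨hp1, hpN⟩, hpp⟩ := mem_upTo.1 hp
    refine mul_le_mul_of_nonneg_right ?_ (Real.log_natCast_nonneg p)
    have h3 : N / p ≤ N.factorial.factorization p := by
      rw [Nat.factorization_factorial hpp (Nat.lt_succ_self (Nat.log p N))]
      have h4 : 1 ∈ Finset.Ico 1 (Nat.log p N).succ := by
        have := Nat.log_pos hpp.one_lt hpN
        exact Finset.mem_Ico.2 ⟨le_rfl, by omega⟩
      have := Finset.single_le_sum (f := fun i => N / p ^ i) (fun _ _ => Nat.zero_le _) h4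
      simpa using this
    have h4 : (N / p : ℝ) < (N / p : ℕ) + 1 := by
      have := Nat.lt_floor_add_one (N / p : ℝ)
      rwa [Nat.floor_div_eq_div] at this
    have h5 : ((N / p : ℕ) : ℝ) ≤ N.factorial.factorization p := by exact_mod_cast h3
    linarith
  have h3 := (Finset.sum_le_sum h2).trans h1
  have h4 : ∑ p ∈ upTo {p | p.Prime} N, (N / p - 1 : ℝ) * Real.log p =
      N * logSum {p | p.Prime} N - ∑ p ∈ upTo {p | p.Prime} N, Real.log p := by
    rw [logSum_natCast, Finset.mul_sum, ← Finset.sum_sub_distrib]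
    exact Finset.sum_congr rfl fun p _ => by ring
  have h5 := sum_log_primes_le N
  rw [h4] at h3
  have : (N : ℝ) * logSum {p | p.Prime} N ≤ N * (Real.log N + Real.log 4) := by linarith
  exact le_of_mul_le_mul_left this hNr

/-- The subtracted term on the right is chosen so that its decrease from `N` to `N + 1` dominates
the new summand. The bound controls the higher prime powers in `le_logSum_primes`. -/
theorem sum_log_div_mul_pred_le (N : ℕ) (hN : 1 ≤ N) :
    ∑ n ∈ Finset.Icc 2 N, Real.log n / (n * (n - 1)) ≤ 2 - (Real.log N + 2) / N := by
  induction N, hN using Nat.le_induction with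
  | base => simp
  | succ N hN ih =>
    have hNr : (1 : ℝ) ≤ N := by exact_mod_cast hN
    have h : Finset.Icc 2 (N + 1) = insert (N + 1) (Finset.Icc 2 N) := by
      ext; simp; omega
    rw [h, Finset.sum_insert (by simp)]
    have h1 : Real.log (N + 1) - Real.log N ≤ 1 / N := by
      rw [← Real.log_div (by positivity) (by positivity)]
      have := Real.log_le_sub_one_of_pos (x := (N + 1 : ℝ) / N) (by positivity)
      refine this.trans (le_of_eq ?_)
      field_simp; ring
    push_cast
    have h2 : Real.log (N + 1) / ((N + 1) * (N + 1 - 1)) ≤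
        (Real.log N + 2) / N - (Real.log (N + 1) + 2) / (N + 1) := by
      have e : (N : ℝ) + 1 - 1 = N := by ring
      rw [e, div_sub_div _ _ (by positivity) (by positivity), div_le_div_iff₀ (by positivity)
        (by positivity)]
      have h3 : (N + 1 : ℝ) * (Real.log (N + 1) - Real.log N) ≤ 2 := by
        calc (N + 1 : ℝ) * (Real.log (N + 1) - Real.log N) ≤ (N + 1) * (1 / N) := by gcongr
          _ ≤ 2 := by
            rw [mul_one_div, div_le_iff₀ (by positivity)]; linarith
      have h4 : Real.log (N + 1) ≤ (Real.log N + 2) * (N + 1) - N * (Real.log (N + 1) + 2) := by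
        linarith
      have h5 : (0 : ℝ) ≤ N * (N + 1) := by positivity
      calc Real.log (N + 1) * (N * (N + 1))
          ≤ ((Real.log N + 2) * (N + 1) - N * (Real.log (N + 1) + 2)) * (N * (N + 1)) := by gcongr
        _ = _ := by ring
    linarith

/-- The exponent of `p` in `N!` is at most `N / (p - 1) = N / p + N / (p (p - 1))`; Stirling bounds
`log N!` below by `N log N - N`. The constant is `3 = 1 + 2`, from Stirling and the convergent sum.
-/
theorem le_logSum_primes {N : ℕ} (hN : 1 ≤ N) :
    Real.log N - 3 ≤ logSum {p | p.Prime} N := by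
  have hNr : (1 : ℝ) ≤ N := by exact_mod_cast hN
  have h1 : N * Real.log N - N ≤ Real.log (N.factorial : ℝ) := by
    have := Stirling.le_log_factorial_stirling (n := N) (by omega)
    have h2 : 0 ≤ Real.log (N : ℝ) := Real.log_natCast_nonneg N
    have h3 : 0 ≤ Real.log (2 * Real.pi) := Real.log_nonneg (by linarith [Real.pi_gt_three])
    linarith
  rw [log_factorial_eq] at h1
  have h2 : ∑ p ∈ upTo {p | p.Prime} N, (N.factorial.factorization p : ℝ) * Real.log p ≤
      ∑ p ∈ upTo {p | p.Prime} N, (N * (Real.log p / p) + N * (Real.log p / (p * (p - 1)))) := by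
    refine Finset.sum_le_sum fun p hp => ?_
    obtain ⟨⟨hp1, hpN⟩, hpp⟩ := mem_upTo.1 hp
    have hp2 : (2 : ℝ) ≤ p := by exact_mod_cast hpp.two_le
    have h3 : (N.factorial.factorization p : ℝ) ≤ N / (p - 1) := by
      have h := Nat.factorization_factorial_le_div_pred hpp N
      have h' : (N.factorial.factorization p : ℝ) ≤ ((N / (p - 1) : ℕ) : ℝ) := by exact_mod_cast h
      refine h'.trans (Nat.cast_div_le.trans (le_of_eq ?_))
      rw [Nat.cast_sub hp1]; simp
    refine (mul_le_mul_of_nonneg_right h3 (Real.log_natCast_nonneg p)).trans (le_of_eq ?_)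
    have : (p : ℝ) - 1 ≠ 0 := by linarith
    have : (p : ℝ) ≠ 0 := by linarith
    field_simp
    ring
  have h3 : ∑ p ∈ upTo {p | p.Prime} N, Real.log p / ((p : ℝ) * (p - 1)) ≤ 2 := by
    have h4 := sum_log_div_mul_pred_le N hN
    have h5 : 0 ≤ (Real.log N + 2) / (N : ℝ) := by
      have := Real.log_natCast_nonneg N
      positivity
    refine le_trans (Finset.sum_le_sum_of_subset_of_nonneg (t := Finset.Icc 2 N) ?_ ?_) (by linarith)
    · intro p hp
      obtain ⟨⟨hp1, hpN⟩, hpp⟩ := mem_upTo.1 hp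
      exact Finset.mem_Icc.2 ⟨Nat.Prime.two_le hpp, hpN⟩
    · intro n hn _
      have : (2 : ℝ) ≤ n := by exact_mod_cast (Finset.mem_Icc.1 hn).1
      refine div_nonneg (Real.log_natCast_nonneg n) (mul_nonneg (by linarith) (by linarith))
  rw [Finset.sum_add_distrib, ← Finset.mul_sum, ← Finset.mul_sum, ← logSum_natCast] at h2
  have h4 : (N : ℝ) * (Real.log N - 3) ≤ N * logSum {p | p.Prime} N := by
    have : (N : ℝ) * ∑ p ∈ upTo {p | p.Prime} N, Real.log p / ((p : ℝ) * (p - 1)) ≤ N * 2 := by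
      gcongr
    linarith
  exact le_of_mul_le_mul_left h4 (by linarith)

/-- Partial summation: a bound for the sum of `log p / p` gives one for the sum of `1 / p`. -/
theorem sum_inv_le_of_logSum_le {U : Set ℕ} {σ E : ℝ} (hσ : 0 ≤ σ)
    (h : ∀ N : ℕ, 1 ≤ N → logSum U N ≤ σ * Real.log N + E) :
    ∃ K : ℝ, ∀ N : ℕ, 2 ≤ N →
      ∑ p ∈ upTo U N, (1 / p : ℝ) ≤ σ * Real.log (Real.log N) + K := by
  -- Chosen so that `hmain` below is an equality at `N = 2`.
  set K := ∑ p ∈ upTo U 2, (1 / p : ℝ) - (logSum U (2 : ℕ) - E) / Real.log (2 : ℕ) -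
    σ * Real.log (Real.log (2 : ℕ)) with hK
  refine ⟨K + σ, fun N hN => ?_⟩
  have hpos : ∀ N : ℕ, 2 ≤ N → 0 < Real.log N := fun N hN =>
    Real.log_pos (by exact_mod_cast hN)
  have hmain : ∑ p ∈ upTo U N, (1 / p : ℝ) ≤ (logSum U N - E) / Real.log N +
      σ * Real.log (Real.log N) + K := by
    induction N, hN using Nat.le_induction with
    | base => rw [hK]; exact le_of_eq (by ring)
    | succ N hN ih =>
      have ha := hpos N hN
      have hb := hpos (N + 1) (by omega)
      have hX := h N (by omega)
      have hab : Real.log N ≤ Real.log (N + 1 : ℕ) :=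
        Real.log_le_log (by positivity) (by push_cast; linarith)
      set a := Real.log N
      set b := Real.log (N + 1 : ℕ)
      -- With the sum up to `N` frozen, passing from `a = log N` to `b = log (N + 1)` loses at most
      -- `σ (1 - a / b)`, because `logSum U N - E ≤ σ a`; the growth of `σ log log` covers this.
      have key : (logSum U N - E) / a + σ * Real.log a ≤
          (logSum U N - E) / b + σ * Real.log b := by
        have h1 : 1 - a / b ≤ Real.log b - Real.log a := by
          have := Real.one_sub_inv_le_log_of_pos (x := b / a) (by positivity)
          rwa [inv_div, Real.log_div hb.ne' ha.ne'] at this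
        have h2 : (logSum U N - E) * (1 / a - 1 / b) ≤ (σ * a) * (1 / a - 1 / b) := by
          refine mul_le_mul_of_nonneg_right (by linarith) ?_
          exact sub_nonneg.2 (one_div_le_one_div_of_le ha hab)
        have h3 : (σ * a) * (1 / a - 1 / b) = σ * (1 - a / b) := by field_simp
        have h4 := mul_le_mul_of_nonneg_left h1 hσ
        have h5 : (logSum U N - E) * (1 / a - 1 / b) =
          (logSum U N - E) / a - (logSum U N - E) / b := by ring
        linarith
      have hl : logSum U (N + 1 : ℕ) = ∑ p ∈ upTo U (N + 1), Real.log p / p := logSum_natCast _ _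
      have hl' := logSum_natCast U N
      rcases upTo_succ_sum U N (fun p => 1 / (p : ℝ)) with ⟨hU, h1⟩ | ⟨hU, h1⟩
      · rcases upTo_succ_sum U N (fun p => Real.log p / (p : ℝ)) with ⟨-, h2⟩ | ⟨hU', -⟩
        · rw [h1, hl, h2, ← hl']
          have : (logSum U N + b / (N + 1 : ℕ) - E) / b =
              (logSum U N - E) / b + 1 / (N + 1 : ℕ) := by
            field_simp; ring
          rw [this]
          linarith
        · exact absurd hU hU'
      · rcases upTo_succ_sum U N (fun p => Real.log p / (p : ℝ)) with ⟨hU', -⟩ | ⟨-, h2⟩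
        · exact absurd hU' hU
        · rw [h1, hl, h2, ← hl']
          linarith
  have h1 : (logSum U N - E) / Real.log N ≤ σ := by
    rw [div_le_iff₀ (hpos N hN)]
    linarith [h N (by omega)]
  linarith

/-! ### Weighted sums over squarefree integers -/

/-- The sum of `∏ p ∈ S, g p` over the subsets `S` of `PP` whose product is at most `x`. -/
noncomputable def subsetSum (g : ℕ → ℝ) (PP : Finset ℕ) (x : ℝ) : ℝ :=
  ∑ S ∈ PP.powerset, if ((∏ p ∈ S, p : ℕ) : ℝ) ≤ x then ∏ p ∈ S, g p else 0

theorem subsetSum_eq_filter (g : ℕ → ℝ) (PP : Finset ℕ) (x : ℝ) :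
    subsetSum g PP x =
      ∑ S ∈ PP.powerset.filter (fun S => ((∏ p ∈ S, p : ℕ) : ℝ) ≤ x), ∏ p ∈ S, g p :=
  (Finset.sum_filter _ _).symm

theorem subsetSum_nonneg {g : ℕ → ℝ} {PP : Finset ℕ} (hg : ∀ p ∈ PP, 0 ≤ g p) (x : ℝ) :
    0 ≤ subsetSum g PP x := by
  refine Finset.sum_nonneg fun S hS => ?_
  split_ifs
  · exact Finset.prod_nonneg fun p hp => hg p (Finset.mem_powerset.1 hS hp)
  · exact le_rfl

theorem subsetSum_mono {g g' : ℕ → ℝ} {PP PP' : Finset ℕ} {x x' : ℝ} (hg : ∀ p ∈ PP, 0 ≤ g p)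
    (hgg : ∀ p ∈ PP, g p ≤ g' p) (hg' : ∀ p ∈ PP', 0 ≤ g' p) (hPP : PP ⊆ PP') (hx : x ≤ x') :
    subsetSum g PP x ≤ subsetSum g' PP' x' := by
  refine le_trans (Finset.sum_le_sum (g := fun S => if ((∏ p ∈ S, p : ℕ) : ℝ) ≤ x' then
    ∏ p ∈ S, g' p else 0) fun S hS => ?_)
    (Finset.sum_le_sum_of_subset_of_nonneg (Finset.powerset_mono.2 hPP) fun S hS _ => ?_)
  · have hS' := Finset.mem_powerset.1 hS
    split_ifs with h1 h2 h2
    · exact Finset.prod_le_prod (fun p hp => hg p (hS' hp)) fun p hp => hgg p (hS' hp)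
    · exact absurd (h1.trans hx) h2
    · exact Finset.prod_nonneg fun p hp => hg' p (hPP (hS' hp))
    · exact le_rfl
  · split_ifs
    · exact Finset.prod_nonneg fun p hp => hg' p (Finset.mem_powerset.1 hS hp)
    · exact le_rfl

theorem subsetSum_insert {g : ℕ → ℝ} {PP : Finset ℕ} {q : ℕ} (hq : q ∉ PP) (hq0 : 0 < q) (x : ℝ) :
    subsetSum g (insert q PP) x = subsetSum g PP x + g q * subsetSum g PP (x / q) := by
  classical
  have hqr : (0 : ℝ) < q := by exact_mod_cast hq0
  rw [subsetSum, Finset.sum_powerset_insert hq, subsetSum, subsetSum, Finset.mul_sum]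
  congr 1
  refine Finset.sum_congr rfl fun S hS => ?_
  have hqS : q ∉ S := fun h => hq (Finset.mem_powerset.1 hS h)
  rw [Finset.prod_insert hqS, Finset.prod_insert hqS]
  have : ((q * ∏ p ∈ S, p : ℕ) : ℝ) ≤ x ↔ ((∏ p ∈ S, p : ℕ) : ℝ) ≤ x / q := by
    rw [le_div_iff₀ hqr, Nat.cast_mul, mul_comm]
  simp only [this, mul_ite, mul_zero]

/-- Send a pair of subsets to its union: a prime of the union lies in the first only, the second
only, or both, which gives the weight `g + h + g h`. The induction adds one prime at a time. -/
theorem subsetSum_mul_le {g h : ℕ → ℝ} {PP : Finset ℕ} (hPP : ∀ p ∈ PP, 0 < p)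
    (hg : ∀ p ∈ PP, 0 ≤ g p) (hh : ∀ p ∈ PP, 0 ≤ h p) {x y : ℝ} (hx : 0 ≤ x) (hy : 0 ≤ y) :
    subsetSum g PP x * subsetSum h PP y ≤ subsetSum (fun p => g p + h p + g p * h p) PP (x * y) := by
  classical
  induction PP using Finset.induction_on generalizing x y with
  | empty =>
    simp only [subsetSum, Finset.powerset_empty, Finset.sum_singleton, Finset.prod_empty,
      Nat.cast_one]
    split_ifs with h1 h2 h3
    · simp
    · exact absurd (by nlinarith) h3
    all_goals simp
  | insert q s hq ih =>
    have hs := fun p hp => hPP p (Finset.mem_insert_of_mem (s := s) hp)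
    have hgs := fun p hp => hg p (Finset.mem_insert_of_mem (s := s) hp)
    have hhs := fun p hp => hh p (Finset.mem_insert_of_mem (s := s) hp)
    have hq0 := hPP q (Finset.mem_insert_self q s)
    have hqr : (1 : ℝ) ≤ q := by exact_mod_cast hq0
    have hgq := hg q (Finset.mem_insert_self q s)
    have hhq := hh q (Finset.mem_insert_self q s)
    rw [subsetSum_insert hq hq0, subsetSum_insert hq hq0, subsetSum_insert hq hq0]
    set F := fun p => g p + h p + g p * h p with hF
    have hF0 : ∀ p ∈ s, 0 ≤ F p := fun p hp =>
      add_nonneg (add_nonneg (hgs p hp) (hhs p hp)) (mul_nonneg (hgs p hp) (hhs p hp))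
    have hxq : 0 ≤ x / q := by positivity
    have hyq : 0 ≤ y / q := by positivity
    have i1 := ih hs hgs hhs hx hy
    have i2 := ih hs hgs hhs hxq hy
    have i3 := ih hs hgs hhs hx hyq
    have i4 := ih hs hgs hhs hxq hyq
    have e2 : x / q * y = x * y / q := by ring
    have e3 : x * (y / q) = x * y / q := by ring
    -- A prime in both subsets is counted once in the union, so the size constraint only relaxes.
    have e4 : x / q * (y / q) ≤ x * y / q := by
      rw [← e3]
      exact mul_le_mul_of_nonneg_right (div_le_self hx hqr) hyq
    rw [e2] at i2
    rw [e3] at i3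
    replace i4 := i4.trans (subsetSum_mono hF0 (fun _ _ => le_rfl) hF0 subset_rfl e4)
    have j2 := mul_le_mul_of_nonneg_left i2 hgq
    have j3 := mul_le_mul_of_nonneg_left i3 hhq
    have j4 := mul_le_mul_of_nonneg_left i4 (mul_nonneg hgq hhq)
    linarith

theorem one_le_subsetSum {g : ℕ → ℝ} {PP : Finset ℕ} (hg : ∀ p ∈ PP, 0 ≤ g p) {x : ℝ}
    (hx : 1 ≤ x) : 1 ≤ subsetSum g PP x := by
  have := subsetSum_mono (PP := ∅) (g := g) (x := 1) (by simp) (fun _ _ => le_rfl) hg (by simp) hx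
  refine le_trans (le_of_eq ?_) this
  simp [subsetSum]

theorem subsetSum_pow_le {PP : Finset ℕ} (hPP : ∀ p ∈ PP, 0 < p) {x : ℝ} (hx : 0 ≤ x) (k : ℕ) :
    subsetSum (fun p => 1 / (p : ℝ)) PP x ^ k ≤
      subsetSum (fun p => (1 + 1 / (p : ℝ)) ^ k - 1) PP (x ^ k) := by
  have h0 : ∀ k : ℕ, ∀ p ∈ PP, (0 : ℝ) ≤ (1 + 1 / (p : ℝ)) ^ k - 1 := fun k p _ =>
    sub_nonneg.2 (one_le_pow₀ (by simp))
  induction k with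
  | zero => simpa using one_le_subsetSum (h0 0) le_rfl
  | succ k ih =>
    rw [pow_succ, pow_succ]
    refine (mul_le_mul_of_nonneg_right ih (subsetSum_nonneg (fun p _ => by positivity) x)).trans ?_
    refine (subsetSum_mul_le hPP (h0 k) (fun p _ => by positivity) (by positivity) hx).trans ?_
    refine le_of_eq ?_
    congr 1
    funext p
    ring

/-- Bernoulli gives `1 - k / p ≤ (1 - 1 / p) ^ k`, and `(1 + 1 / p) (1 - 1 / p) ≤ 1`. The right side
is the large sieve weight for `k` excluded classes, so `subsetSum_pow_le` bounds the sieve sum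
below. -/
theorem one_add_inv_pow_sub_one_le {k p : ℕ} (h : k < p) :
    (1 + 1 / (p : ℝ)) ^ k - 1 ≤ k / (p - k) := by
  have hp : (1 : ℝ) ≤ p := by exact_mod_cast (by omega : 1 ≤ p)
  have hpk : (k : ℝ) < p := by exact_mod_cast h
  have h1 : 1 - (k : ℝ) / p ≤ (1 - 1 / p) ^ k := by
    have := one_add_mul_le_pow (a := -(1 / (p : ℝ))) (by
      have : 1 / (p : ℝ) ≤ 1 := by rw [div_le_one (by positivity)]; exact hp
      linarith) k
    calc 1 - (k : ℝ) / p = 1 + k * -(1 / (p : ℝ)) := by ring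
      _ ≤ _ := this
      _ = _ := by ring
  have h2 : (1 + 1 / (p : ℝ)) ^ k * (1 - k / p) ≤ 1 := by
    calc (1 + 1 / (p : ℝ)) ^ k * (1 - k / p) ≤ (1 + 1 / (p : ℝ)) ^ k * (1 - 1 / p) ^ k := by
          gcongr
      _ = (1 - (1 / (p : ℝ)) ^ 2) ^ k := by rw [← mul_pow]; ring
      _ ≤ 1 := by
        refine pow_le_one₀ ?_ (by linarith [sq_nonneg (1 / (p : ℝ))])
        have : (1 / (p : ℝ)) ^ 2 ≤ 1 := by
          refine pow_le_one₀ (by positivity) ?_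
          rw [div_le_one (by positivity)]; exact hp
        linarith
  have h3 : (0 : ℝ) < p - k := by linarith
  rw [le_div_iff₀ h3]
  have h4 : (1 + 1 / (p : ℝ)) ^ k * (1 - k / p) * p ≤ 1 * p := by gcongr
  have h5 : (1 + 1 / (p : ℝ)) ^ k * (1 - k / p) * p = (1 + 1 / (p : ℝ)) ^ k * (p - k) := by
    field_simp
  linarith

/-- Every `n ≤ N` is a squarefree number times a square, and the squarefree part splits into primes
of `U` and primes of `V`. The harmonic sum is thus at most a product of three sums, the one over
squares being at most `2`. -/
theorem log_le_subsetSum_mul_prod {U V : Set ℕ} (hUV : ∀ p : ℕ, p.Prime → p ∈ U ∨ p ∈ V) {N : ℕ} :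
    Real.log N ≤ 2 * subsetSum (fun p => 1 / (p : ℝ)) (upTo U N) N *
      ∏ p ∈ upTo V N, (1 + 1 / (p : ℝ)) := by
  classical
  set Fam := (upTo U N).powerset.filter (fun S => ((∏ p ∈ S, p : ℕ) : ℝ) ≤ N) with hFam
  set W := Fam ×ˢ (upTo V N).powerset ×ˢ Finset.Icc 1 N with hW
  let w : Finset ℕ × Finset ℕ × ℕ → ℝ := fun t =>
    (∏ p ∈ t.1, 1 / (p : ℝ)) * ((∏ p ∈ t.2.1, 1 / (p : ℝ)) * ((t.2.2 : ℝ) ^ 2)⁻¹)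
  have hex : ∀ n ∈ Finset.Icc 1 N, ∃ t ∈ W,
      n = (∏ p ∈ t.1, p) * ((∏ p ∈ t.2.1, p) * t.2.2 ^ 2) := by
    intro n hn
    obtain ⟨hn1, hnN⟩ := Finset.mem_Icc.1 hn
    obtain ⟨a, b, ha, hb, hab, hsq⟩ := Nat.sq_mul_squarefree_of_pos (by omega : 0 < n)
    have haN : a ≤ N := (Nat.le_of_dvd (by omega) (Dvd.intro_left _ hab)).trans hnN
    have hbN : b ≤ N := (Nat.le_of_dvd (by omega)
      (hab ▸ dvd_mul_of_dvd_left (dvd_pow_self b two_ne_zero) a)).trans hnN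
    have hprod := Nat.prod_primeFactors_of_squarefree hsq
    have hsplit := Finset.prod_filter_mul_prod_filter_not a.primeFactors (· ∈ U) (fun p => p)
    have hle : ∀ p ∈ a.primeFactors, 1 ≤ p ∧ p ≤ N := fun p hp =>
      ⟨(Nat.prime_of_mem_primeFactors hp).one_le, (Nat.le_of_mem_primeFactors hp).trans haN⟩
    refine ⟨(a.primeFactors.filter (· ∈ U), a.primeFactors.filter (¬ · ∈ U), b), ?_, ?_⟩
    · simp only [hW, hFam, Finset.mem_product, Finset.mem_filter, Finset.mem_powerset,
        Finset.mem_Icc]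
      refine ⟨⟨fun p hp => ?_, ?_⟩, fun p hp => ?_, hb, hbN⟩
      · obtain ⟨h1, h2⟩ := Finset.mem_filter.1 hp
        exact mem_upTo.2 ⟨hle p h1, h2⟩
      · have : ∏ p ∈ a.primeFactors.filter (· ∈ U), p ≤ a := by
          exact Nat.le_of_dvd ha (Dvd.intro _ (hsplit.trans hprod))
        exact_mod_cast this.trans haN
      · obtain ⟨h1, h2⟩ := Finset.mem_filter.1 hp
        exact mem_upTo.2 ⟨hle p h1, (hUV p (Nat.prime_of_mem_primeFactors h1)).resolve_left h2⟩
    · simp only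
      rw [← mul_assoc, hsplit, hprod, ← hab, mul_comm]
  choose! φ hφ hφn using hex
  have hw0 : ∀ t, 0 ≤ w t := fun t => by positivity
  have h1 : ∑ n ∈ Finset.Icc 1 N, ((n : ℝ))⁻¹ ≤ ∑ t ∈ W, w t := by
    calc ∑ n ∈ Finset.Icc 1 N, ((n : ℝ))⁻¹ = ∑ n ∈ Finset.Icc 1 N, w (φ n) := by
          refine Finset.sum_congr rfl fun n hn => ?_
          conv_lhs => rw [hφn n hn]
          push_cast
          simp only [w, mul_inv, Finset.prod_inv_distrib, one_div]
      _ = ∑ t ∈ (Finset.Icc 1 N).image φ, w t := by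
          refine (Finset.sum_image fun n hn m hm hnm => ?_).symm
          rw [hφn n hn, hφn m hm, hnm]
      _ ≤ _ := by
          refine Finset.sum_le_sum_of_subset_of_nonneg (fun t ht => ?_) fun t _ _ => hw0 t
          obtain ⟨n, hn, rfl⟩ := Finset.mem_image.1 ht
          exact hφ n hn
  have h2 : ∑ t ∈ W, w t = subsetSum (fun p => 1 / (p : ℝ)) (upTo U N) N *
      ((∏ p ∈ upTo V N, (1 + 1 / (p : ℝ))) * ∑ m ∈ Finset.Icc 1 N, ((m : ℝ) ^ 2)⁻¹) := by
    rw [hW, subsetSum_eq_filter, Finset.prod_one_add, Finset.sum_mul_sum, Finset.sum_mul_sum,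
      Finset.sum_product]
    refine Finset.sum_congr rfl fun S _ => ?_
    rw [Finset.sum_product]
    simp only [Finset.mul_sum, w]
  have h3 : ∑ m ∈ Finset.Icc 1 N, ((m : ℝ) ^ 2)⁻¹ ≤ 2 := by
    have := sum_Ioo_inv_sq_le (α := ℝ) 0 (N + 1)
    have e : Finset.Ioo 0 (N + 1) = Finset.Icc 1 N := by ext; simp; omega
    rw [e] at this
    simpa using this
  have h4 : Real.log N ≤ ∑ n ∈ Finset.Icc 1 N, ((n : ℝ))⁻¹ := by
    rcases Nat.eq_zero_or_pos N with rfl | hN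
    · simp
    have := log_add_one_le_harmonic N
    rw [harmonic_eq_sum_Icc] at this
    push_cast at this
    refine le_trans (Real.log_le_log (by exact_mod_cast hN) (by linarith)) this
  have h5 : 0 ≤ subsetSum (fun p => 1 / (p : ℝ)) (upTo U N) N :=
    subsetSum_nonneg (fun p _ => by positivity) _
  have h6 : 0 ≤ ∏ p ∈ upTo V N, (1 + 1 / (p : ℝ)) := Finset.prod_nonneg fun p _ => by positivity
  calc Real.log N ≤ _ := h4.trans (h1.trans h2.le)
    _ ≤ subsetSum (fun p => 1 / (p : ℝ)) (upTo U N) N *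
      ((∏ p ∈ upTo V N, (1 + 1 / (p : ℝ))) * 2) := by gcongr
    _ = _ := by ring

/-- If the primes outside `U` have relative logarithmic density at most `σ`, then the sum of the
reciprocals of the squarefree integers up to `N` composed of primes in `U` is at least of order
`(log N) ^ (1 - σ)`. -/
theorem exists_le_subsetSum {U V : Set ℕ} (hUV : ∀ p : ℕ, p.Prime → p ∈ U ∨ p ∈ V) {σ K : ℝ}
    (h : ∀ N : ℕ, 2 ≤ N → ∑ p ∈ upTo V N, (1 / p : ℝ) ≤ σ * Real.log (Real.log N) + K) :
    ∃ c : ℝ, 0 < c ∧ ∀ N : ℕ, 2 ≤ N →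
      c * Real.log N ^ (1 - σ) ≤ subsetSum (fun p => 1 / (p : ℝ)) (upTo U N) N := by
  refine ⟨1 / (2 * Real.exp K), by positivity, fun N hN => ?_⟩
  have hlog : 0 < Real.log N := Real.log_pos (by exact_mod_cast hN)
  have h1 := log_le_subsetSum_mul_prod hUV (N := N)
  have h2 : ∏ p ∈ upTo V N, (1 + 1 / (p : ℝ)) ≤ Real.exp K * Real.log N ^ σ := by
    calc ∏ p ∈ upTo V N, (1 + 1 / (p : ℝ)) ≤ ∏ p ∈ upTo V N, Real.exp (1 / (p : ℝ)) :=
          Finset.prod_le_prod (fun p _ => by positivity) fun p _ => by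
            rw [add_comm]; exact Real.add_one_le_exp _
      _ = Real.exp (∑ p ∈ upTo V N, (1 / (p : ℝ))) := (Real.exp_sum _ _).symm
      _ ≤ Real.exp (σ * Real.log (Real.log N) + K) := Real.exp_le_exp.2 (h N hN)
      _ = _ := by rw [Real.exp_add, Real.rpow_def_of_pos hlog, mul_comm σ, mul_comm]
  have h5 : 0 ≤ subsetSum (fun p => 1 / (p : ℝ)) (upTo U N) N :=
    subsetSum_nonneg (fun p _ => by positivity) _
  have h3 := h1.trans (mul_le_mul_of_nonneg_left h2 (by positivity))
  have h4 : Real.log N ^ σ * Real.log N ^ (1 - σ) = Real.log N := by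
    rw [← Real.rpow_add hlog]; simp
  have h6 : 0 < Real.log N ^ σ := Real.rpow_pos_of_pos hlog _
  rw [div_mul_eq_mul_div, one_mul, div_le_iff₀ (by positivity)]
  refine le_of_mul_le_mul_left ?_ h6
  rw [h4]
  linarith

/-! ### Logarithmic density of `T` and of its complement -/

theorem upTo_mono_right (U : Set ℕ) {M N : ℕ} (h : M ≤ N) : upTo U M ⊆ upTo U N := fun p hp => by
  obtain ⟨⟨h1, h2⟩, h3⟩ := mem_upTo.1 hp
  exact mem_upTo.2 ⟨⟨h1, h2.trans h⟩, h3⟩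

theorem logSum_natCast_mono (U : Set ℕ) {M N : ℕ} (h : M ≤ N) : logSum U M ≤ logSum U N := by
  rw [logSum_natCast, logSum_natCast]
  exact Finset.sum_le_sum_of_subset_of_nonneg (upTo_mono_right U h) fun p _ _ =>
    div_nonneg (Real.log_natCast_nonneg p) (by positivity)

theorem exists_abs_logSum_sub_le {T : Set ℕ} {τ C : ℝ} (hτ0 : 0 < τ)
    (hsum : (fun x : ℝ => logSum T x - (τ * Real.log x + C)) =o[atTop] (fun _ : ℝ => (1 : ℝ))) :
    ∃ E : ℝ, ∀ N : ℕ, 1 ≤ N → |logSum T N - τ * Real.log N| ≤ E := by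
  have h1 := hsum.def (c := 1) one_pos
  obtain ⟨x1, hx1⟩ := eventually_atTop.1 (tendsto_natCast_atTop_atTop.eventually h1)
  refine ⟨1 + |C| + (logSum T (x1 : ℝ) + τ * Real.log x1), fun N hN => ?_⟩
  have h0 : ∀ M : ℕ, 0 ≤ logSum T M := fun M => by
    rw [logSum_natCast]
    exact Finset.sum_nonneg fun p _ => div_nonneg (Real.log_natCast_nonneg p) (by positivity)
  have hl := Real.log_natCast_nonneg x1
  have hl' := Real.log_natCast_nonneg N
  have hxx := h0 x1
  have hNN := h0 N
  have hτl : 0 ≤ τ * Real.log x1 := by positivity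
  have hτl' : 0 ≤ τ * Real.log N := by positivity
  have hC := abs_nonneg C
  rcases le_or_gt x1 N with h | h
  · have h2 := hx1 N h
    simp only [Real.norm_eq_abs, norm_one, mul_one] at h2
    have h3 := abs_add_le (logSum T N - (τ * Real.log N + C)) C
    have e : logSum T N - (τ * Real.log N + C) + C = logSum T N - τ * Real.log N := by ring
    rw [e] at h3
    linarith
  · have h2 := logSum_natCast_mono T h.le
    have h3 : τ * Real.log N ≤ τ * Real.log x1 :=
      mul_le_mul_of_nonneg_left (Real.log_le_log (by exact_mod_cast hN) (by exact_mod_cast h.le))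
        hτ0.le
    rw [abs_le]
    constructor <;> linarith

theorem logSum_compl {T : Set ℕ} (hT : ∀ p ∈ T, p.Prime) (N : ℕ) :
    logSum {p | p.Prime ∧ p ∉ T} N = logSum {p | p.Prime} N - logSum T N := by
  classical
  rw [eq_sub_iff_add_eq, logSum_natCast, logSum_natCast, logSum_natCast, ← Finset.sum_union]
  · refine Finset.sum_congr ?_ fun _ _ => rfl
    ext p
    simp only [Finset.mem_union, mem_upTo, Set.mem_ofPred_eq]
    constructor
    · rintro (⟨h1, h2, -⟩ | ⟨h1, h2⟩)
      · exact ⟨h1, h2⟩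
      · exact ⟨h1, hT p h2⟩
    · rintro ⟨h1, h2⟩
      by_cases h : p ∈ T
      · exact Or.inr ⟨h1, h⟩
      · exact Or.inl ⟨h1, h2, h⟩
  · rw [Finset.disjoint_left]
    intro p hp hp'
    exact (mem_upTo.1 hp).2.2 (mem_upTo.1 hp').2

theorem exists_abs_logSum_compl_sub_le {T : Set ℕ} (hT : ∀ p ∈ T, p.Prime) {τ E : ℝ}
    (hE : ∀ N : ℕ, 1 ≤ N → |logSum T N - τ * Real.log N| ≤ E) :
    ∀ N : ℕ, 1 ≤ N →
      |logSum {p | p.Prime ∧ p ∉ T} N - (1 - τ) * Real.log N| ≤ E + 3 := by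
  intro N hN
  have h1 := logSum_primes_le hN
  have h2 := le_logSum_primes hN
  have h3 := abs_le.1 (hE N hN)
  have h4 : Real.log 4 ≤ 3 := by
    have := Real.log_le_sub_one_of_pos (x := 4) (by norm_num)
    linarith
  rw [logSum_compl hT, abs_le]
  constructor <;> linarith [h3.1, h3.2]

/-! ### Sieving one summand by finitely many elements of the other -/

/-- The residues modulo `p` of the negatives of the elements of `C`. -/
def negResidues (C : Finset ℕ) (p : ℕ) : Finset ℕ :=
  (C.image (· % p)).image fun a => (p - a) % p

theorem negResidues_subset {C : Finset ℕ} {p : ℕ} (hp : 0 < p) :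
    negResidues C p ⊆ Finset.range p := by
  intro a ha
  obtain ⟨b, -, rfl⟩ := Finset.mem_image.1 ha
  exact Finset.mem_range.2 (Nat.mod_lt _ hp)

theorem card_negResidues {C : Finset ℕ} {p : ℕ} (hp : 0 < p) :
    (negResidues C p).card = (C.image (· % p)).card := by
  refine Finset.card_image_of_injOn ?_
  have hlt : ∀ a ∈ C.image (· % p), a < p := fun a ha => by
    obtain ⟨b, -, rfl⟩ := Finset.mem_image.1 ha
    exact Nat.mod_lt _ hp
  have hval : ∀ a < p, (p - a) % p = if a = 0 then 0 else p - a := fun a ha => by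
    split_ifs with h
    · simp [h]
    · exact Nat.mod_eq_of_lt (by omega)
  intro a ha b hb hab
  have ha' := hlt a ha
  have hb' := hlt b hb
  simp only [hval a ha', hval b hb'] at hab
  split_ifs at hab <;> omega

theorem exists_dvd_add_of_mem_negResidues {C : Finset ℕ} {p n : ℕ} (hp : 0 < p)
    (h : n % p ∈ negResidues C p) : ∃ c ∈ C, p ∣ n + c := by
  obtain ⟨a, ha, h1⟩ := Finset.mem_image.1 h
  obtain ⟨c, hc, rfl⟩ := Finset.mem_image.1 ha
  refine ⟨c, hc, Nat.dvd_of_mod_eq_zero ?_⟩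
  have : c % p < p := Nat.mod_lt _ hp
  rw [Nat.add_mod, ← h1, Nat.mod_add_mod, Nat.sub_add_cancel this.le, Nat.mod_self]

/-- From the point `x₀` on, the sumset `C + D` consists of elements of `Q T`. -/
def SumsInQ (T C D : Set ℕ) (x₀ : ℕ) : Prop :=
  ∀ c ∈ C, ∀ d ∈ D, x₀ ≤ c + d → c + d ∈ Q T

/-- From the point `x₀` on, every element of `Q T` lies in the sumset `C + D`. -/
def SumsCoverQ (T C D : Set ℕ) (x₀ : ℕ) : Prop :=
  ∀ n ∈ Q T, x₀ ≤ n → ∃ c ∈ C, ∃ d ∈ D, c + d = n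

theorem card_upTo_le_add_filter (D : Set ℕ) (x₀ N : ℕ) :
    (upTo D N).card ≤ x₀ + ((upTo D N).filter (x₀ ≤ ·)).card := by
  classical
  rw [← Finset.card_filter_add_card_filter_not (s := upTo D N) (x₀ ≤ ·), add_comm]
  gcongr
  calc _ ≤ (Finset.range x₀).card := Finset.card_le_card fun p hp => by
        have := (Finset.mem_filter.1 hp).2
        exact Finset.mem_range.2 (by omega)
    _ = x₀ := Finset.card_range _

/-- The large sieve, applied to a summand. -/
theorem large_sieve_summand {T C D : Set ℕ} {x₀ : ℕ} (hCD : SumsInQ T C D x₀)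
    {C' : Finset ℕ} (hC' : ∀ c ∈ C', c ∈ C) {PP : Finset ℕ} (hPP : ∀ p ∈ PP, p.Prime ∧ p ∉ T)
    {N : ℕ} (hN : 1 ≤ N) {Fam : Finset (Finset ℕ)}
    (hFam : ∀ S ∈ Fam, S ⊆ PP ∧ (∏ p ∈ S, p) ^ 2 ≤ 6 * N) :
    (((upTo D N).filter (x₀ ≤ ·)).card : ℝ) * ∑ S ∈ Fam, ∏ p ∈ S,
      ((C'.image (· % p)).card / (p - (C'.image (· % p)).card) : ℝ) ≤ 24 * N := by
  have h := large_sieve (PP := PP) (r := negResidues C') (N := N) (Fam := Fam)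
    (X := (upTo D N).filter (x₀ ≤ ·)) (fun p hp => (hPP p hp).1)
    (fun p hp => negResidues_subset (hPP p hp).1.pos) hN hFam
    (fun n hn => (mem_upTo.1 (Finset.mem_filter.1 hn).1).1.2) (fun n hn p hp hmem => by
      obtain ⟨hn1, hn2⟩ := Finset.mem_filter.1 hn
      -- A sieved class would give a prime outside `T` dividing an element of `Q T`.
      obtain ⟨c, hc, hdvd⟩ := exists_dvd_add_of_mem_negResidues (hPP p hp).1.pos hmem
      rw [add_comm] at hdvd
      have := hCD c (hC' c hc) n (mem_upTo.1 hn1).2 (by omega)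
      exact (hPP p hp).2 (this.2 p (hPP p hp).1 hdvd))
  refine le_trans (le_of_eq ?_) h
  congr 1
  refine Finset.sum_congr rfl fun S hS => Finset.prod_congr rfl fun p hp => ?_
  rw [card_negResidues (hPP p ((hFam S hS).1 hp)).1.pos]

/-- For `p > B` the elements of `C'` are distinct modulo `p`, and `C'.card < p`, so exactly
`C'.card` classes are excluded. The sieve level is `n ^ C'.card`, whose square is at most `N`. -/
theorem card_mul_subsetSum_pow_le {T C D : Set ℕ} {x₀ : ℕ} (hCD : SumsInQ T C D x₀)
    {C' : Finset ℕ} (hC' : ∀ c ∈ C', c ∈ C) {B : ℕ} (hB : ∀ c ∈ C', c ≤ B) (hkB : C'.card ≤ B)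
    {n N : ℕ} (hN : 1 ≤ N) (hn : n ^ (2 * C'.card) ≤ N) :
    (((upTo D N).filter (x₀ ≤ ·)).card : ℝ) *
      subsetSum (fun p => 1 / (p : ℝ)) (upTo {p | p.Prime ∧ p ∉ T ∧ B < p} n) n ^ C'.card ≤
      24 * N := by
  set PP := upTo {p | p.Prime ∧ p ∉ T ∧ B < p} n with hPPdef
  have hPP : ∀ p ∈ PP, p.Prime ∧ p ∉ T ∧ B < p := fun p hp => (mem_upTo.1 hp).2
  have hk : ∀ p ∈ PP, (C'.image (· % p)).card = C'.card := fun p hp => by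
    refine Finset.card_image_of_injOn fun a ha b hb hab => ?_
    have h1 := hB a ha
    have h2 := hB b hb
    have h3 := (hPP p hp).2.2
    change a % p = b % p at hab
    rwa [Nat.mod_eq_of_lt (by omega), Nat.mod_eq_of_lt (by omega)] at hab
  have h1 := large_sieve_summand hCD hC' (PP := PP) (fun p hp => ⟨(hPP p hp).1, (hPP p hp).2.1⟩)
    hN (Fam := PP.powerset.filter (fun S => ((∏ p ∈ S, p : ℕ) : ℝ) ≤ (n : ℝ) ^ C'.card))
    (fun S hS => by
      obtain ⟨h1, h2⟩ := Finset.mem_filter.1 hS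
      refine ⟨Finset.mem_powerset.1 h1, ?_⟩
      have h3 : ∏ p ∈ S, p ≤ n ^ C'.card := by exact_mod_cast h2
      calc (∏ p ∈ S, p) ^ 2 ≤ (n ^ C'.card) ^ 2 := Nat.pow_le_pow_left h3 2
        _ = n ^ (2 * C'.card) := by rw [← pow_mul, mul_comm]
        _ ≤ 6 * N := by omega)
  refine le_trans (mul_le_mul_of_nonneg_left ?_ (by positivity)) h1
  have hlt : ∀ p ∈ PP, C'.card < p := fun p hp => lt_of_le_of_lt hkB (hPP p hp).2.2
  refine (subsetSum_pow_le (fun p hp => (hPP p hp).1.pos) (by positivity) _).trans ?_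
  refine (subsetSum_mono (g' := fun p => (C'.card / (p - C'.card) : ℝ)) (PP' := PP)
    (fun p _ => sub_nonneg.2 (one_le_pow₀ (by simp)))
    (fun p hp => one_add_inv_pow_sub_one_le (hlt p hp)) (fun p hp => ?_) subset_rfl le_rfl).trans
    (le_of_eq ?_)
  · have : (C'.card : ℝ) < p := by exact_mod_cast hlt p hp
    exact div_nonneg (by positivity) (by linarith)
  · rw [subsetSum_eq_filter]
    refine Finset.sum_congr rfl fun S hS => Finset.prod_congr rfl fun p hp => ?_
    rw [hk p (Finset.mem_powerset.1 (Finset.mem_filter.1 hS).1 hp)]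

/-- Take the integer part `n` of the `k`-th root. As `n ≥ 2`, one has `n + 1 ≤ n ^ 2`, so `N < n ^
(2 * k)`. -/
theorem exists_root {k : ℕ} (hk : 1 ≤ k) {N : ℕ} (hN : 2 ^ k ≤ N) :
    ∃ n : ℕ, 2 ≤ n ∧ n ^ k ≤ N ∧ Real.log N / (2 * k) ≤ Real.log n := by
  have hN0 : N ≠ 0 := by have := Nat.pow_pos (n := k) (show 0 < 2 by norm_num); omega
  have hex : ∃ m : ℕ, N < m ^ k := ⟨N + 1, lt_of_lt_of_le (Nat.lt_succ_self N)
    (Nat.le_self_pow (by omega) _)⟩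
  obtain ⟨m, hm, hmin⟩ : ∃ m : ℕ, N < (m + 1) ^ k ∧ m ^ k ≤ N := by
    have h1 := Nat.find_spec hex
    have h0 : Nat.find hex ≠ 0 := fun h => by
      rw [h, zero_pow (by omega)] at h1; omega
    obtain ⟨m, hm⟩ := Nat.exists_eq_succ_of_ne_zero h0
    refine ⟨m, by rw [← Nat.succ_eq_add_one, ← hm]; exact h1, ?_⟩
    exact not_lt.1 (Nat.find_min hex (by omega))
  have hm2 : 2 ≤ m := by
    by_contra hcon
    have : (m + 1) ^ k ≤ 2 ^ k := Nat.pow_le_pow_left (by omega) k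
    omega
  refine ⟨m, hm2, hmin, ?_⟩
  have h1 : (N : ℝ) ≤ (m : ℝ) ^ (2 * k) := by
    have : (m + 1) ^ k ≤ (m ^ 2) ^ k := Nat.pow_le_pow_left (by nlinarith) k
    rw [pow_mul]
    exact_mod_cast hm.le.trans this
  have hk' : (0 : ℝ) < k := by exact_mod_cast hk
  rw [div_le_iff₀ (by positivity)]
  have := Real.log_le_log (by positivity) h1
  rw [Real.log_pow] at this
  push_cast at this
  linarith

/-- If `C` contains `k` elements, then the other summand has `≪ N / (log N) ^ (k * (1 - τ))`
elements up to `N`. -/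
theorem eventually_card_summand_le {T C D : Set ℕ} {τ E : ℝ} (hτ0 : 0 < τ)
    (hτ1 : τ < 1) (hE : ∀ N : ℕ, 1 ≤ N → |logSum T N - τ * Real.log N| ≤ E)
    {x₀ : ℕ} (hCD : SumsInQ T C D x₀) {C' : Finset ℕ} (hC' : ∀ c ∈ C', c ∈ C)
    (hk : 1 ≤ C'.card) {s : ℝ} (hs : s < C'.card * (1 - τ)) :
    ∀ᶠ N : ℕ in atTop, ((upTo D N).card : ℝ) ≤ N / Real.log N ^ s := by
  set k := C'.card with hkdef
  set B := C'.sup id + k with hB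
  have hTsum : ∃ K : ℝ, ∀ N : ℕ, 2 ≤ N →
      ∑ p ∈ upTo T N, (1 / p : ℝ) ≤ τ * Real.log (Real.log N) + K :=
    sum_inv_le_of_logSum_le (E := E) hτ0.le fun N hN => by linarith [(abs_le.1 (hE N hN)).2]
  obtain ⟨K, hK⟩ := hTsum
  -- Discarding the primes up to `B` changes the reciprocal sum only by a constant.
  obtain ⟨c, hc, hcN⟩ := exists_le_subsetSum (U := {p | p.Prime ∧ p ∉ T ∧ B < p})
    (V := {p | p ∈ T ∨ p ≤ B}) (σ := τ) (K := K + ∑ p ∈ Finset.Icc 1 B, (1 / p : ℝ)) (by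
      intro p hp
      by_cases h1 : p ∈ T
      · exact Or.inr (Or.inl h1)
      · rcases le_or_gt p B with h2 | h2
        · exact Or.inr (Or.inr h2)
        · exact Or.inl ⟨hp, h1, h2⟩) (by
      classical
      intro N hN
      have h1 : ∑ p ∈ upTo {p | p ∈ T ∨ p ≤ B} N, (1 / p : ℝ) ≤
          ∑ p ∈ upTo T N ∪ Finset.Icc 1 B, (1 / p : ℝ) := by
        refine Finset.sum_le_sum_of_subset_of_nonneg (fun p hp => ?_) fun p _ _ => by positivity
        obtain ⟨h1, h2 | h2⟩ := mem_upTo.1 hp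
        · exact Finset.mem_union_left _ (mem_upTo.2 ⟨h1, h2⟩)
        · exact Finset.mem_union_right _ (Finset.mem_Icc.2 ⟨h1.1, h2⟩)
      have h2 : ∑ p ∈ upTo T N ∪ Finset.Icc 1 B, (1 / p : ℝ) ≤
          ∑ p ∈ upTo T N, (1 / p : ℝ) + ∑ p ∈ Finset.Icc 1 B, (1 / p : ℝ) := by
        rw [← Finset.sum_union_inter]
        exact le_add_of_nonneg_right (Finset.sum_nonneg fun p _ => by positivity)
      linarith [hK N hN])
  have hkr : (1 : ℝ) ≤ k := by exact_mod_cast hk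
  set A := (c * (1 / (2 * (2 * k : ℕ))) ^ (1 - τ)) ^ k with hA
  have hApos : 0 < A := by positivity
  have hmain : ∀ N : ℕ, 2 ^ (2 * k) ≤ N → (((upTo D N).filter (x₀ ≤ ·)).card : ℝ) *
      (A * Real.log N ^ (k * (1 - τ))) ≤ 24 * N := by
    intro N hN
    obtain ⟨n, hn2, hnN, hlog⟩ := exists_root (k := 2 * k) (by omega) hN
    have hN1 : 1 ≤ N := le_trans Nat.one_le_two_pow hN
    have hlogN := Real.log_natCast_nonneg N
    refine le_trans (mul_le_mul_of_nonneg_left ?_ (by positivity))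
      (card_mul_subsetSum_pow_le hCD hC' (B := B) (fun a ha => ?_) (by omega) hN1 hnN)
    · have h1 : A * Real.log N ^ (k * (1 - τ)) =
          (c * (Real.log N / (2 * (2 * k : ℕ))) ^ (1 - τ)) ^ k := by
        rw [hA, mul_comm (k : ℝ), Real.rpow_mul hlogN, Real.rpow_natCast, ← mul_pow, mul_assoc,
          ← Real.mul_rpow (by positivity) hlogN]
        congr 3
        ring
      rw [h1]
      refine pow_le_pow_left₀ (by positivity) (le_trans ?_ (hcN n hn2)) k
      refine mul_le_mul_of_nonneg_left (Real.rpow_le_rpow (by positivity) hlog (by linarith)) hc.le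
    · have := Finset.le_sup (f := id) ha
      simp only [id] at this
      omega
  have hlogtop : Tendsto (fun N : ℕ => Real.log N) atTop atTop :=
    Real.tendsto_log_atTop.comp tendsto_natCast_atTop_atTop
  -- The constant `48 = 2 * 24` leaves half of the bound for the at most `x₀` elements below `x₀`,
  -- which `ev2` handles.
  have ev1 : ∀ᶠ N : ℕ in atTop, 48 / A ≤ Real.log N ^ (k * (1 - τ) - s) :=
    ((tendsto_rpow_atTop (by linarith)).comp hlogtop).eventually_ge_atTop _
  have ev2 : ∀ᶠ N : ℕ in atTop, 2 * (x₀ : ℝ) * Real.log N ^ s ≤ N := by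
    have h1 := (isLittleO_log_rpow_rpow_atTop s (one_pos)).comp_tendsto
      tendsto_natCast_atTop_atTop (k := (Nat.cast : ℕ → ℝ))
    have h2 := h1.def (c := 1 / (2 * x₀ + 1)) (by positivity)
    filter_upwards [h2, hlogtop.eventually_ge_atTop 1] with N h3 h4
    simp only [Function.comp, Real.rpow_one, Real.norm_eq_abs, Nat.abs_cast] at h3
    have h5 := (le_abs_self _).trans h3
    have h6 : (0 : ℝ) ≤ Real.log N ^ s := by positivity
    rw [div_mul_eq_mul_div, one_mul, le_div_iff₀ (by positivity)] at h5
    linarith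
  filter_upwards [ev1, ev2, eventually_ge_atTop (2 ^ (2 * k)), hlogtop.eventually_ge_atTop 1]
    with N h1 h2 h3 h4
  have h5 := hmain N h3
  have h6 : ((upTo D N).card : ℝ) ≤ x₀ + ((upTo D N).filter (x₀ ≤ ·)).card := by
    exact_mod_cast card_upTo_le_add_filter D x₀ N
  have hl : 0 < Real.log N := by linarith
  have hls : 0 < Real.log N ^ s := Real.rpow_pos_of_pos hl _
  rw [le_div_iff₀ hls]
  have h7 : Real.log N ^ (k * (1 - τ)) = Real.log N ^ (k * (1 - τ) - s) * Real.log N ^ s := by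
    rw [← Real.rpow_add hl]; congr 1; ring
  rw [h7] at h5
  set X := (((upTo D N).filter (x₀ ≤ ·)).card : ℝ)
  have hX : 0 ≤ X := by positivity
  have h8 : X * (48 * Real.log N ^ s) ≤ 24 * N := by
    refine le_trans (mul_le_mul_of_nonneg_left ?_ hX) h5
    rw [← mul_assoc]
    refine mul_le_mul_of_nonneg_right ?_ hls.le
    rwa [div_le_iff₀ hApos, mul_comm] at h1
  have h9 := mul_le_mul_of_nonneg_right h6 hls.le
  linarith

/-! ### A lower bound for the counting function of `Q T` -/

theorem tendsto_log_natCast : Tendsto (fun N : ℕ => Real.log N) atTop atTop :=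
  Real.tendsto_log_atTop.comp tendsto_natCast_atTop_atTop

theorem subsetSum_le_sum_inv_Q {T : Set ℕ} (hT : ∀ p ∈ T, p.Prime) (N : ℕ) :
    subsetSum (fun p => 1 / (p : ℝ)) (upTo T N) N ≤ ∑ n ∈ upTo (Q T) N, (1 / n : ℝ) := by
  classical
  rw [subsetSum_eq_filter]
  set Fam := (upTo T N).powerset.filter (fun S => ((∏ p ∈ S, p : ℕ) : ℝ) ≤ N)
  have hFam : ∀ S ∈ Fam, (∀ p ∈ S, p.Prime ∧ p ∈ T) ∧ ∏ p ∈ S, p ≤ N := fun S hS => by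
    obtain ⟨h1, h2⟩ := Finset.mem_filter.1 hS
    refine ⟨fun p hp => ?_, by exact_mod_cast h2⟩
    have := (mem_upTo.1 (Finset.mem_powerset.1 h1 hp)).2
    exact ⟨hT p this, this⟩
  calc ∑ S ∈ Fam, ∏ p ∈ S, 1 / (p : ℝ) = ∑ S ∈ Fam, (1 / ((∏ p ∈ S, p : ℕ) : ℝ)) := by
        refine Finset.sum_congr rfl fun S _ => ?_
        push_cast
        simp
    _ = ∑ n ∈ Fam.image (fun S => ∏ p ∈ S, p), (1 / n : ℝ) := by
        refine (Finset.sum_image (f := fun n : ℕ => (1 / n : ℝ)) fun S hS S' hS' h => ?_).symm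
        rw [← Nat.primeFactors_prod (fun p hp => ((hFam S hS).1 p hp).1),
          ← Nat.primeFactors_prod (fun p hp => ((hFam S' hS').1 p hp).1)]
        exact congrArg _ h
    _ ≤ _ := by
        refine Finset.sum_le_sum_of_subset_of_nonneg (fun n hn => ?_) fun n _ _ => by positivity
        obtain ⟨S, hS, rfl⟩ := Finset.mem_image.1 hn
        have hpos : 0 < ∏ p ∈ S, p := Finset.prod_pos fun p hp => ((hFam S hS).1 p hp).1.pos
        refine mem_upTo.2 ⟨⟨hpos, (hFam S hS).2⟩, hpos, fun q hq hdvd => ?_⟩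
        obtain ⟨p, hp, hqp⟩ := (hq.prime.dvd_finsetProd_iff _).1 hdvd
        rw [(Nat.prime_dvd_prime_iff_eq hq ((hFam S hS).1 p hp).1).1 hqp]
        exact ((hFam S hS).1 p hp).2

/-- Multiplied by `b ^ s`, this is the weighted mean inequality `a ^ (1 - s) * b ^ s ≤ (1 - s) * a +
s * b`. -/
theorem rpow_sub_rpow_ge {a b s : ℝ} (ha : 0 < a) (hab : a ≤ b) (hs0 : 0 ≤ s) (hs1 : s ≤ 1) :
    (1 - s) * (b - a) / b ^ s ≤ b ^ (1 - s) - a ^ (1 - s) := by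
  have hb : 0 < b := ha.trans_le hab
  have hbs : 0 < b ^ s := Real.rpow_pos_of_pos hb _
  have h1 := Real.geom_mean_le_arith_mean2_weighted (w₁ := 1 - s) (w₂ := s) (p₁ := a) (p₂ := b)
    (by linarith) hs0 ha.le hb.le (by ring)
  have h2 : b ^ (1 - s) * b ^ s = b := by rw [← Real.rpow_add hb]; simp
  rw [div_le_iff₀ hbs]
  nlinarith

/-- Partial summation: a set of integers with at most `N / (log N) ^ s` elements up to `N` has
reciprocal sum `≪ (log N) ^ (1 - s)`. -/
theorem exists_sum_inv_le_of_card_le {S : Set ℕ} {s : ℝ} (hs0 : 0 ≤ s) (hs1 : s < 1) {M : ℕ}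
    (hM : 2 ≤ M) (h : ∀ N : ℕ, M ≤ N → ((upTo S N).card : ℝ) ≤ N / Real.log N ^ s) :
    ∃ K : ℝ, ∀ N : ℕ, M ≤ N →
      ∑ n ∈ upTo S N, (1 / n : ℝ) ≤ 2 / (1 - s) * Real.log N ^ (1 - s) + K := by
  have hs : 0 < 1 - s := by linarith
  refine ⟨∑ n ∈ upTo S M, (1 / n : ℝ) + 1, fun N hN => ?_⟩
  -- The term `card / N` is the boundary term of Abel summation; carrying it makes the induction
  -- close.
  have hmain : ∑ n ∈ upTo S N, (1 / n : ℝ) ≤ (upTo S N).card / (N : ℝ) +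
      2 / (1 - s) * Real.log N ^ (1 - s) + ∑ n ∈ upTo S M, (1 / n : ℝ) := by
    induction N, hN using Nat.le_induction with
    | base =>
      have : 0 ≤ Real.log M := Real.log_natCast_nonneg M
      exact le_add_of_nonneg_left (by positivity)
    | succ N hN ih =>
      have hNr : (2 : ℝ) ≤ N := by exact_mod_cast hM.trans hN
      have ha : 0 < Real.log N := Real.log_pos (by linarith)
      have hab : Real.log N ≤ Real.log (N + 1 : ℕ) :=
        Real.log_le_log (by linarith) (by push_cast; linarith)
      have hb2 : Real.log (N + 1 : ℕ) ≤ 2 * Real.log N := by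
        have : ((N + 1 : ℕ) : ℝ) ≤ (N : ℝ) ^ 2 := by push_cast; nlinarith
        have := Real.log_le_log (by positivity) this
        rwa [Real.log_pow, Nat.cast_two] at this
      have hdiff : 1 / ((N : ℝ) + 1) ≤ Real.log (N + 1 : ℕ) - Real.log N := by
        rw [← Real.log_div (by positivity) (by positivity)]
        have := Real.one_sub_inv_le_log_of_pos (x := ((N + 1 : ℕ) : ℝ) / N) (by positivity)
        refine le_trans (le_of_eq ?_) this
        push_cast
        field_simp
        ring
      set a := Real.log N
      set b := Real.log (N + 1 : ℕ)
      have hb : 0 < b := ha.trans_le hab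
      have h1 := rpow_sub_rpow_ge ha hab hs0 hs1.le
      have has : 0 < a ^ s := Real.rpow_pos_of_pos ha _
      have hbs : 0 < b ^ s := Real.rpow_pos_of_pos hb _
      have h2 : b ^ s ≤ 2 * a ^ s := by
        calc b ^ s ≤ (2 * a) ^ s := Real.rpow_le_rpow hb.le hb2 hs0
          _ = 2 ^ s * a ^ s := Real.mul_rpow (by norm_num) ha.le
          _ ≤ 2 ^ (1 : ℝ) * a ^ s := by
            gcongr
            norm_num
          _ = _ := by simp
      have h3 : 1 / (a ^ s * (N + 1)) ≤ 2 / (1 - s) * (b ^ (1 - s) - a ^ (1 - s)) := by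
        calc 1 / (a ^ s * (N + 1)) ≤ 2 * (1 / ((N : ℝ) + 1)) / b ^ s := by
              rw [mul_one_div, div_div, div_le_div_iff₀ (by positivity) (by positivity)]
              nlinarith
          _ ≤ 2 * (b - a) / b ^ s := by gcongr
          _ = 2 / (1 - s) * ((1 - s) * (b - a) / b ^ s) := by field_simp
          _ ≤ _ := by gcongr
      have h4 : ((upTo S N).card : ℝ) / (N * (N + 1)) ≤ 1 / (a ^ s * (N + 1)) := by
        have := h N hN
        rw [div_le_div_iff₀ (by positivity) (by positivity)]
        rw [le_div_iff₀ has] at this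
        nlinarith
      have h5 : ((upTo S N).card : ℝ) / N =
          (upTo S N).card / (N + 1) + (upTo S N).card / (N * (N + 1)) := by
        field_simp
      have hc : ∀ N, ((upTo S N).card : ℝ) = ∑ n ∈ upTo S N, (1 : ℝ) := fun N => by simp
      rcases upTo_succ_sum S N (fun n => 1 / (n : ℝ)) with ⟨hU, e1⟩ | ⟨hU, e1⟩
      · rcases upTo_succ_sum S N (fun n => 1) with ⟨-, e2⟩ | ⟨hU', -⟩
        · rw [e1, hc (N + 1), e2, ← hc N]
          push_cast
          rw [add_div]
          linarith
        · exact absurd hU hU'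
      · rcases upTo_succ_sum S N (fun n => 1) with ⟨hU', -⟩ | ⟨-, e2⟩
        · exact absurd hU' hU
        · rw [e1, hc (N + 1), e2, ← hc N]
          push_cast
          linarith
  have hcard : ((upTo S N).card : ℝ) / N ≤ 1 := by
    refine div_le_one_of_le₀ ?_ (by positivity)
    have h1 : (upTo S N).card ≤ (Finset.Icc 1 N).card := Finset.card_le_card fun p hp =>
      Finset.mem_Icc.2 (mem_upTo.1 hp).1
    rw [Nat.card_Icc] at h1
    exact_mod_cast h1.trans (by omega)
  linarith

/-- The reciprocals of the elements of `Q T` up to `N` sum to `≫ (log N) ^ τ`, whereas a count at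
most `N / (log N) ^ s` from some point on would force `≪ (log N) ^ (1 - s)` with `1 - s < τ`. The
argument through averages gives infinitely many `N` only. -/
theorem frequently_card_Q_ge {T : Set ℕ} (hT : ∀ p ∈ T, p.Prime) {τ E : ℝ}
    (hτ1 : τ < 1) (hE : ∀ N : ℕ, 1 ≤ N → |logSum T N - τ * Real.log N| ≤ E)
    {s : ℝ} (hs : 1 - τ < s) (hs1 : s < 1) :
    ∃ᶠ N : ℕ in atTop, (N : ℝ) / Real.log N ^ s < (upTo (Q T) N).card := by
  intro hcon
  simp only [not_lt] at hcon
  obtain ⟨M, hM⟩ := eventually_atTop.1 hcon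
  obtain ⟨K, hK⟩ := exists_sum_inv_le_of_card_le (S := Q T) (s := s) (by linarith) hs1
    (M := max M 2) (le_max_right _ _) fun N hN => hM N ((le_max_left _ _).trans hN)
  have hE' := exists_abs_logSum_compl_sub_le hT hE
  obtain ⟨K', hK'⟩ := sum_inv_le_of_logSum_le (U := {p | p.Prime ∧ p ∉ T}) (σ := 1 - τ)
    (E := E + 3) (by linarith) fun N hN => by linarith [(abs_le.1 (hE' N hN)).2]
  obtain ⟨c, hc, hcN⟩ := exists_le_subsetSum (U := T) (V := {p | p.Prime ∧ p ∉ T})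
    (fun p hp => by
      by_cases h : p ∈ T
      · exact Or.inl h
      · exact Or.inr ⟨hp, h⟩) hK'
  rw [sub_sub_cancel] at hcN
  set κ := 2 / (1 - s) with hκ
  have hev := ((tendsto_rpow_atTop (y := τ - (1 - s)) (by linarith)).comp
    tendsto_log_natCast).eventually_gt_atTop ((κ + |K|) / c)
  obtain ⟨N, h1, h2, h3⟩ := (hev.and ((eventually_ge_atTop (max M 2)).and
    (tendsto_log_natCast.eventually_ge_atTop 1))).exists
  have hl : 0 < Real.log N := by linarith
  have h4 := (hcN N ((le_max_right _ _).trans h2)).trans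
    ((subsetSum_le_sum_inv_Q hT N).trans (hK N h2))
  have h5 : 1 ≤ Real.log N ^ (1 - s) := Real.one_le_rpow h3 (by linarith)
  have h6 : Real.log N ^ τ = Real.log N ^ (τ - (1 - s)) * Real.log N ^ (1 - s) := by
    rw [← Real.rpow_add hl]; congr 1; ring
  simp only [Function.comp] at h1
  rw [div_lt_iff₀ hc] at h1
  have h7 : K ≤ |K| * Real.log N ^ (1 - s) := by
    nlinarith [le_abs_self K, abs_nonneg K]
  have h8 : (κ + |K|) * Real.log N ^ (1 - s) <
      Real.log N ^ (τ - (1 - s)) * c * Real.log N ^ (1 - s) :=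
    mul_lt_mul_of_pos_right h1 (by linarith)
  rw [h6] at h4
  linarith

/-! ### Infinitude of the summands in a binary decomposition -/

theorem card_upTo_Q_le {T C D : Set ℕ} {x₀ : ℕ} (hcov : SumsCoverQ T C D x₀)
    (hC0 : ∀ c ∈ C, 0 < c) (hD0 : ∀ d ∈ D, 0 < d) (N : ℕ) :
    (upTo (Q T) N).card ≤ x₀ + (upTo C N).card * (upTo D N).card := by
  classical
  refine (card_upTo_le_add_filter (Q T) x₀ N).trans ?_
  gcongr
  calc _ ≤ (upTo C N + upTo D N).card := Finset.card_le_card fun n hn => by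
        obtain ⟨h1, h2⟩ := Finset.mem_filter.1 hn
        obtain ⟨⟨-, h3⟩, h4⟩ := mem_upTo.1 h1
        obtain ⟨c, hc, d, hd, rfl⟩ := hcov n h4 h2
        exact Finset.add_mem_add (mem_upTo.2 ⟨⟨hC0 c hc, by omega⟩, hc⟩)
          (mem_upTo.2 ⟨⟨hD0 d hd, by omega⟩, hd⟩)
    _ ≤ _ := Finset.card_add_le

theorem eventually_const_mul_div_le {s s' : ℝ} (hs : s < s') (a b : ℝ) :
    ∀ᶠ N : ℕ in atTop, a + b * (N / Real.log N ^ s') ≤ N / Real.log N ^ s := by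
  have ev1 : ∀ᶠ N : ℕ in atTop, 2 * |b| ≤ Real.log N ^ (s' - s) :=
    ((tendsto_rpow_atTop (by linarith)).comp tendsto_log_natCast).eventually_ge_atTop _
  have ev2 : ∀ᶠ N : ℕ in atTop, 2 * |a| * Real.log N ^ s ≤ N := by
    have h1 := (isLittleO_log_rpow_rpow_atTop s (one_pos)).comp_tendsto
      tendsto_natCast_atTop_atTop (k := (Nat.cast : ℕ → ℝ))
    have h2 := h1.def (c := 1 / (2 * |a| + 1)) (by positivity)
    filter_upwards [h2, tendsto_log_natCast.eventually_ge_atTop 1] with N h3 h4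
    simp only [Function.comp, Real.rpow_one, Real.norm_eq_abs, Nat.abs_cast] at h3
    have h5 := (le_abs_self _).trans h3
    have h6 : (0 : ℝ) ≤ Real.log N ^ s := by positivity
    rw [div_mul_eq_mul_div, one_mul, le_div_iff₀ (by positivity)] at h5
    linarith
  filter_upwards [ev1, ev2, tendsto_log_natCast.eventually_ge_atTop 1] with N h1 h2 h3
  have hl : 0 < Real.log N := by linarith
  have hls : 0 < Real.log N ^ s := Real.rpow_pos_of_pos hl _
  have hld : 0 < Real.log N ^ (s' - s) := Real.rpow_pos_of_pos hl _
  have h4 : Real.log N ^ s' = Real.log N ^ (s' - s) * Real.log N ^ s := by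
    rw [← Real.rpow_add hl]; congr 1; ring
  have h5 : b * (N / Real.log N ^ s') ≤ N / Real.log N ^ s / 2 := by
    rw [h4]
    calc b * (N / (Real.log N ^ (s' - s) * Real.log N ^ s))
        ≤ |b| * (N / (Real.log N ^ (s' - s) * Real.log N ^ s)) := by
          gcongr
          exact le_abs_self b
      _ ≤ (Real.log N ^ (s' - s) / 2) * (N / (Real.log N ^ (s' - s) * Real.log N ^ s)) := by
          gcongr
          linarith
      _ = _ := by field_simp
  have h6 : a ≤ N / Real.log N ^ s / 2 := by
    rw [div_div, le_div_iff₀ (by positivity)]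
    nlinarith [le_abs_self a]
  linarith

/-- A finite `C` with at least two elements makes `D`, and hence `C + D`, as small as `N / (log N) ^
s'` up to a constant factor, for some `s' > 1 - τ`. This contradicts the frequent lower bound for `Q
T`. -/
theorem summand_infinite {T C D : Set ℕ} (hT : ∀ p ∈ T, p.Prime) {τ E : ℝ} (hτ0 : 0 < τ)
    (hτ1 : τ < 1) (hE : ∀ N : ℕ, 1 ≤ N → |logSum T N - τ * Real.log N| ≤ E)
    {x₀ : ℕ} (hCD : SumsInQ T C D x₀) (hcov : SumsCoverQ T C D x₀)
    (hC0 : ∀ c ∈ C, 0 < c) (hD0 : ∀ d ∈ D, 0 < d) (hC2 : 2 ≤ C.encard) : C.Infinite := by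
  intro hfin
  have hcard : (2 : ℝ) ≤ hfin.toFinset.card := by
    rw [hfin.encard_eq_coe_toFinset_card] at hC2
    exact_mod_cast hC2
  obtain ⟨s, hs1, hs2⟩ := exists_between (show 1 - τ < min 1 (2 * (1 - τ)) from
    lt_min (by linarith) (by linarith))
  obtain ⟨s', hs1', hs2'⟩ := exists_between (lt_min_iff.1 hs2).2
  have ev1 := eventually_card_summand_le (C' := hfin.toFinset) hτ0 hτ1 hE hCD (by simp)
    (by exact_mod_cast (by linarith : (1 : ℝ) ≤ hfin.toFinset.card))
    (s := s') (by nlinarith)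
  have ev2 := eventually_const_mul_div_le hs1' x₀ hfin.toFinset.card
  obtain ⟨N, h1, h2, h3⟩ := ((frequently_card_Q_ge hT hτ1 hE hs1 (lt_min_iff.1 hs2).1).and_eventually
    (ev1.and ev2)).exists
  have h4 : ((upTo (Q T) N).card : ℝ) ≤ x₀ + (upTo C N).card * (upTo D N).card := by
    exact_mod_cast card_upTo_Q_le hcov hC0 hD0 N
  have h5 : ((upTo C N).card : ℝ) ≤ hfin.toFinset.card := by
    exact_mod_cast Finset.card_le_card fun c hc => by simpa using (mem_upTo.1 hc).2
  have h6 : ((upTo C N).card : ℝ) * (upTo D N).card ≤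
      hfin.toFinset.card * (N / Real.log N ^ s') := by gcongr
  linarith

/-! ### The larger sieve -/

/-- Cauchy–Schwarz over the occupied classes; the squares of the fibre sizes count congruent ordered
pairs, with the diagonal split off. -/
theorem card_sq_le_mul_card_congruent (C : Finset ℕ) (p : ℕ) :
    C.card ^ 2 ≤ (C.image (· % p)).card *
      (C.card + (C.offDiag.filter fun t => t.1 % p = t.2 % p).card) := by
  classical
  have h1 : C.card = ∑ a ∈ C.image (· % p), (C.filter fun c => c % p = a).card :=
    Finset.card_eq_sum_card_fiberwise fun c hc => Finset.mem_image_of_mem _ hc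
  have h2 : C.card + (C.offDiag.filter fun t => t.1 % p = t.2 % p).card =
      ((C ×ˢ C).filter fun t => t.1 % p = t.2 % p).card := by
    rw [← Finset.diag_union_offDiag, Finset.filter_union, Finset.card_union_of_disjoint
      (Finset.disjoint_filter_filter (Finset.disjoint_diag_offDiag C)), ← Finset.diag_card C]
    congr 2
    refine (Finset.filter_true_of_mem fun t ht => ?_).symm
    rw [(Finset.mem_diag.1 ht).2]
  have h3 : ((C ×ˢ C).filter fun t => t.1 % p = t.2 % p).card =
      ∑ a ∈ C.image (· % p), (C.filter fun c => c % p = a).card ^ 2 := by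
    rw [Finset.card_eq_sum_card_fiberwise (f := fun t => t.1 % p) (t := C.image (· % p))]
    · refine Finset.sum_congr rfl fun a _ => ?_
      rw [sq, ← Finset.card_product]
      congr 1
      ext ⟨x, y⟩
      simp only [Finset.mem_filter, Finset.mem_product]
      constructor
      · rintro ⟨⟨⟨hx, hy⟩, hxy⟩, rfl⟩
        exact ⟨⟨hx, rfl⟩, hy, hxy.symm⟩
      · rintro ⟨⟨hx, rfl⟩, hy, hxy⟩
        exact ⟨⟨⟨hx, hy⟩, hxy.symm⟩, rfl⟩
    · intro t ht
      exact Finset.mem_image_of_mem (· % p) (Finset.mem_product.1 (Finset.mem_filter.1 ht).1).1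
  rw [h2, h3]
  conv_lhs => rw [h1]
  exact sq_sum_le_card_mul_sum_sq

/-- The product of these primes divides the nonzero integer `b - a`, whose absolute value is at most
`N`. -/
theorem sum_log_of_congruent_le {PP : Finset ℕ} (hPP : ∀ p ∈ PP, p.Prime) {N a b : ℕ}
    (ha : a ≤ N) (hb : b ≤ N) (hab : a ≠ b) :
    ∑ p ∈ PP.filter (fun p => a % p = b % p), Real.log p ≤ Real.log N := by
  set s := PP.filter (fun p => a % p = b % p)
  have hs : ∀ p ∈ s, p.Prime := fun p hp => hPP p (Finset.mem_filter.1 hp).1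
  rw [← Real.log_prod fun p hp => by exact_mod_cast (hs p hp).ne_zero]
  set δ := ((b : ℤ) - a).natAbs with hδ
  have hδ0 : 0 < δ := by omega
  have hdvd : ∏ p ∈ s, p ∣ δ := by
    refine Finset.prod_primes_dvd _ (fun p hp => (hs p hp).prime) fun p hp => ?_
    have h : a ≡ b [MOD p] := (Finset.mem_filter.1 hp).2
    exact Int.natCast_dvd.1 h.dvd
  have hle : ∏ p ∈ s, p ≤ N := (Nat.le_of_dvd hδ0 hdvd).trans (by omega)
  have hler : ((∏ p ∈ s, p : ℕ) : ℝ) ≤ N := by exact_mod_cast hle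
  rw [Nat.cast_prod] at hler
  exact Real.log_le_log (Finset.prod_pos fun p hp => by exact_mod_cast (hs p hp).pos) hler

/-- Gallagher's larger sieve. -/
theorem larger_sieve {PP : Finset ℕ} (hPP : ∀ p ∈ PP, p.Prime) {C : Finset ℕ} (hC : C.Nonempty)
    {N : ℕ} (hCN : ∀ c ∈ C, c ≤ N) :
    ∑ p ∈ PP, Real.log p / (C.image (· % p)).card ≤
      Real.log N + (∑ p ∈ PP, Real.log p) / C.card := by
  classical
  have hM : (0 : ℝ) < C.card := by exact_mod_cast hC.card_pos
  have h1 : ∀ p ∈ PP, Real.log p / (C.image (· % p)).card ≤ Real.log p / C.card +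
      (∑ t ∈ C.offDiag, if t.1 % p = t.2 % p then Real.log p else 0) / C.card ^ 2 := by
    intro p hp
    have hν : (0 : ℝ) < (C.image (· % p)).card := by exact_mod_cast (hC.image _).card_pos
    have h2 : (C.card : ℝ) ^ 2 ≤ (C.image (· % p)).card *
        (C.card + (C.offDiag.filter fun t => t.1 % p = t.2 % p).card) := by
      exact_mod_cast card_sq_le_mul_card_congruent C p
    rw [← Finset.sum_filter, Finset.sum_const, nsmul_eq_mul, div_add_div _ _ hM.ne' (by positivity),
      div_le_div_iff₀ hν (by positivity)]
    have h3 : 0 ≤ Real.log p := Real.log_natCast_nonneg p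
    set m := ((C.offDiag.filter fun t => t.1 % p = t.2 % p).card : ℝ)
    have h4 := mul_le_mul_of_nonneg_left h2 (mul_nonneg h3 hM.le)
    linarith
  refine (Finset.sum_le_sum h1).trans ?_
  rw [Finset.sum_add_distrib, ← Finset.sum_div, ← Finset.sum_div, Finset.sum_comm, add_comm]
  gcongr
  rw [div_le_iff₀ (by positivity)]
  have h2 : ∑ t ∈ C.offDiag, ∑ p ∈ PP, (if t.1 % p = t.2 % p then Real.log p else 0) ≤
      ∑ t ∈ C.offDiag, Real.log N := by
    refine Finset.sum_le_sum fun t ht => ?_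
    obtain ⟨ha, hb, hab⟩ := Finset.mem_offDiag.1 ht
    rw [← Finset.sum_filter]
    exact sum_log_of_congruent_le hPP (hCN _ ha) (hCN _ hb) hab
  refine h2.trans ?_
  rw [Finset.sum_const, nsmul_eq_mul, mul_comm]
  refine mul_le_mul_of_nonneg_left ?_ (Real.log_natCast_nonneg N)
  rw [Finset.offDiag_card, sq]
  exact_mod_cast Nat.sub_le _ _

/-- A Chebyshev type lower bound for a set of primes of positive logarithmic density. -/
theorem exists_sum_log_ge {P : Set ℕ} {σ E : ℝ} (hσ : 0 < σ)
    (hE : ∀ N : ℕ, 1 ≤ N → |logSum P N - σ * Real.log N| ≤ E) :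
    ∃ c : ℝ, 0 < c ∧ ∀ᶠ y : ℕ in atTop, c * y ≤ ∑ p ∈ upTo P y, Real.log p := by
  obtain ⟨l, hl, hl1⟩ := ((tendsto_log_natCast.eventually_ge_atTop ((2 * E + 1) / σ)).and
    (eventually_ge_atTop 1)).exists
  have hlr : (1 : ℝ) ≤ l := by exact_mod_cast hl1
  refine ⟨1 / l, by positivity, ?_⟩
  filter_upwards [eventually_ge_atTop l] with y hy
  set z := y / l with hz
  have hz1 : 1 ≤ z := Nat.div_pos hy hl1
  have hzy : z ≤ y := Nat.div_le_self _ _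
  have hzr : (z : ℝ) * l ≤ y := by exact_mod_cast Nat.div_mul_le_self y l
  have hzpos : (0 : ℝ) < z := by exact_mod_cast hz1
  have h1 := abs_le.1 (hE y (hz1.trans hzy))
  have h2 := abs_le.1 (hE z hz1)
  have h3 : Real.log z + Real.log l ≤ Real.log y := by
    rw [← Real.log_mul (by positivity) (by positivity)]
    exact Real.log_le_log (by positivity) hzr
  rw [div_le_iff₀ hσ] at hl
  have h4 := mul_le_mul_of_nonneg_left h3 hσ.le
  -- The choice of `l` makes the gain `σ log l` exceed the two errors `E` by `1`; the mass then lies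
  -- on `(y / l, y]`, where `1 / p ≤ l / y`.
  have h5 : 1 ≤ logSum P y - logSum P z := by linarith [h1.1, h2.2]
  rw [logSum_natCast, logSum_natCast, ← Finset.sum_sdiff (upTo_mono_right P hzy),
    add_sub_cancel_right] at h5
  have hypos : (0 : ℝ) < y := by exact_mod_cast hz1.trans hzy
  have h6 : ∑ p ∈ upTo P y \ upTo P z, Real.log p / p ≤
      ∑ p ∈ upTo P y \ upTo P z, (l / y) * Real.log p := by
    refine Finset.sum_le_sum fun p hp => ?_
    obtain ⟨hp1, hp2⟩ := Finset.mem_sdiff.1 hp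
    obtain ⟨⟨hp3, hp4⟩, hp5⟩ := mem_upTo.1 hp1
    have hzp : z < p := by
      by_contra hcon
      exact hp2 (mem_upTo.2 ⟨⟨hp3, by omega⟩, hp5⟩)
    have hyp : y ≤ l * p := by
      have := Nat.lt_mul_of_div_lt hzp hl1
      rw [mul_comm] at this
      exact this.le
    have hyp' : (y : ℝ) ≤ l * p := by exact_mod_cast hyp
    have hppos : (0 : ℝ) < p := by exact_mod_cast hp3
    rw [div_eq_inv_mul]
    refine mul_le_mul_of_nonneg_right ?_ (Real.log_natCast_nonneg p)
    rw [inv_le_comm₀ hppos (by positivity), inv_div, div_le_iff₀ (by positivity)]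
    linarith
  rw [← Finset.mul_sum] at h6
  have h7 : ∑ p ∈ upTo P y \ upTo P z, Real.log p ≤ ∑ p ∈ upTo P y, Real.log p :=
    Finset.sum_le_sum_of_subset_of_nonneg Finset.sdiff_subset fun p _ _ =>
      Real.log_natCast_nonneg p
  have h8 := h5.trans (h6.trans (mul_le_mul_of_nonneg_left h7 (by positivity)))
  rw [div_mul_eq_mul_div, le_div_iff₀ hypos] at h8
  rw [div_mul_eq_mul_div, div_le_iff₀ (by positivity)]
  linarith

/-! ### A power saving for a summand -/

/-- Weakens the weight `ν / (p - ν)` to `ν / p`. Positivity of `p - ν` holds because a surviving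
element of `D` lies in an unsieved class. -/
theorem large_sieve_summand_density {T C D : Set ℕ} {x₀ : ℕ} (hCD : SumsInQ T C D x₀)
    {C' : Finset ℕ} (hC' : ∀ c ∈ C', c ∈ C) {PP : Finset ℕ} (hPP : ∀ p ∈ PP, p.Prime ∧ p ∉ T)
    {N : ℕ} (hN : 1 ≤ N) {Fam : Finset (Finset ℕ)}
    (hFam : ∀ S ∈ Fam, S ⊆ PP ∧ (∏ p ∈ S, p) ^ 2 ≤ 6 * N) :
    (((upTo D N).filter (x₀ ≤ ·)).card : ℝ) * ∑ S ∈ Fam, ∏ p ∈ S,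
      ((C'.image (· % p)).card / p : ℝ) ≤ 24 * N := by
  rcases ((upTo D N).filter (x₀ ≤ ·)).eq_empty_or_nonempty with h | ⟨d, hd⟩
  · rw [h]; simp
  refine le_trans (mul_le_mul_of_nonneg_left ?_ (by positivity))
    (large_sieve_summand hCD hC' hPP hN hFam)
  refine Finset.sum_le_sum fun S hS => Finset.prod_le_prod (fun p _ => by positivity) fun p hp => ?_
  have hp' := hPP p ((hFam S hS).1 hp)
  have hlt : (C'.image (· % p)).card < p := by
    rw [← card_negResidues hp'.1.pos]
    conv_rhs => rw [← Finset.card_range p]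
    refine Finset.card_lt_card ⟨negResidues_subset hp'.1.pos, fun h => ?_⟩
    obtain ⟨c, hc, hdvd⟩ := exists_dvd_add_of_mem_negResidues hp'.1.pos
      (h (Finset.mem_range.2 (Nat.mod_lt d hp'.1.pos)))
    obtain ⟨hd1, hd2⟩ := Finset.mem_filter.1 hd
    rw [add_comm] at hdvd
    exact hp'.2 ((hCD c (hC' c hc) d (mem_upTo.1 hd1).2 (by omega)).2 p hp'.1 hdvd)
  have hlt' : ((C'.image (· % p)).card : ℝ) < p := by exact_mod_cast hlt
  exact div_le_div_of_nonneg_left (by positivity) (by linarith) (by simp)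

/-- A large subset of `[1, N]` occupies many residue classes modulo many primes `p ≤ y`. -/
theorem exists_many_primes_with_many_residues {P : Set ℕ} (hP : ∀ p ∈ P, p.Prime) {C : Finset ℕ}
    {N y : ℕ} {c : ℝ} (hc : 0 < c) (hy : 2 ≤ y) (hyC : y ≤ C.card) (hCN : ∀ a ∈ C, a ≤ N)
    (hN : 2 ≤ Real.log N) (hyP : c * y ≤ ∑ p ∈ upTo P y, Real.log p) :
    ∃ G ⊆ upTo P y, c * y / 2 ≤ G.card * Real.log y ∧
      ∀ p ∈ G, c * y / (4 * Real.log N) ≤ (C.image (· % p)).card := by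
  classical
  have hyr : (2 : ℝ) ≤ y := by exact_mod_cast hy
  have hCr : (y : ℝ) ≤ C.card := by exact_mod_cast hyC
  have hCne : C.Nonempty := Finset.card_pos.1 (by omega)
  -- The larger sieve bounds the sum of `log p / ν p` by `log N + 2 ≤ 2 log N`, where `ν p` is the
  -- number of occupied classes. So the primes with `ν p < W` carry weight at most `W * (2 * log N)
  -- = c * y / 2`, half of the total.
  set W := c * y / (4 * Real.log N) with hW
  have hWpos : 0 < W := by positivity
  refine ⟨(upTo P y).filter (fun p => W ≤ (C.image (· % p)).card), Finset.filter_subset _ _, ?_,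
    fun p hp => (Finset.mem_filter.1 hp).2⟩
  set G := (upTo P y).filter (fun p => W ≤ (C.image (· % p)).card)
  set Bd := (upTo P y).filter (fun p => ¬ W ≤ (C.image (· % p)).card)
  have hsplit : ∑ p ∈ G, Real.log p + ∑ p ∈ Bd, Real.log p = ∑ p ∈ upTo P y, Real.log p :=
    Finset.sum_filter_add_sum_filter_not _ _ _
  have h1 := larger_sieve (PP := upTo P y) (fun p hp => hP p (mem_upTo.1 hp).2) hCne hCN
  have h2 : (∑ p ∈ upTo P y, Real.log p) / C.card ≤ 2 := by
    have h3 : ∑ p ∈ upTo P y, Real.log p ≤ Real.log 4 * y := by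
      refine le_trans (Finset.sum_le_sum_of_subset_of_nonneg (fun p hp => ?_) fun p _ _ =>
        Real.log_natCast_nonneg p) (sum_log_primes_le y)
      obtain ⟨h4, h5⟩ := mem_upTo.1 hp
      exact mem_upTo.2 ⟨h4, hP p h5⟩
    have h4 : Real.log 4 ≤ 2 := by
      have : Real.log 4 = 2 * Real.log 2 := by
        rw [show (4 : ℝ) = 2 ^ 2 by norm_num, Real.log_pow]; norm_num
      linarith [Real.log_two_lt_d9]
    rw [div_le_iff₀ (by linarith)]
    nlinarith
  have h3 : ∑ p ∈ Bd, Real.log p ≤ W * (2 * Real.log N) := by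
    calc ∑ p ∈ Bd, Real.log p ≤ ∑ p ∈ Bd, W * (Real.log p / (C.image (· % p)).card) := by
          refine Finset.sum_le_sum fun p hp => ?_
          have hν : (0 : ℝ) < (C.image (· % p)).card := by exact_mod_cast (hCne.image _).card_pos
          have hlt := (Finset.mem_filter.1 hp).2
          rw [not_le] at hlt
          rw [mul_div_assoc', le_div_iff₀ hν, mul_comm]
          exact mul_le_mul_of_nonneg_right hlt.le (Real.log_natCast_nonneg p)
      _ ≤ W * ∑ p ∈ upTo P y, Real.log p / (C.image (· % p)).card := by
          rw [← Finset.mul_sum]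
          refine mul_le_mul_of_nonneg_left ?_ hWpos.le
          exact Finset.sum_le_sum_of_subset_of_nonneg (Finset.filter_subset _ _) fun p _ _ =>
            div_nonneg (Real.log_natCast_nonneg p) (by positivity)
      _ ≤ _ := mul_le_mul_of_nonneg_left (by linarith) hWpos.le
  have h4 : W * (2 * Real.log N) = c * y / 2 := by
    rw [hW]; field_simp; ring
  have h5 : ∑ p ∈ G, Real.log p ≤ ∑ p ∈ G, Real.log y := by
    refine Finset.sum_le_sum fun p hp => ?_
    obtain ⟨⟨h6, h7⟩, -⟩ := mem_upTo.1 (Finset.mem_filter.1 hp).1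
    exact Real.log_le_log (by exact_mod_cast h6) (by exact_mod_cast h7)
  rw [Finset.sum_const, nsmul_eq_mul] at h5
  linarith

theorem pow_le_choose_mul {G m : ℕ} {l : ℝ} (hl : 0 < l) (hm : (m : ℝ) ≤ l) (hG : 2 * l ≤ G) :
    (G / (2 * l) : ℝ) ^ m ≤ G.choose m := by
  have h1 := Nat.pow_le_choose (α := ℝ) m G
  refine le_trans ?_ h1
  have h2 : (m.factorial : ℝ) ≤ l ^ m := by
    have : (m.factorial : ℝ) ≤ (m : ℝ) ^ m := by exact_mod_cast m.factorial_le_pow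
    exact this.trans (pow_le_pow_left₀ (by positivity) hm m)
  have hmG : m ≤ G := by
    have : (m : ℝ) ≤ G := by linarith
    exact_mod_cast this
  have h3 : (G / 2 : ℝ) ≤ ((G + 1 - m : ℕ) : ℝ) := by
    rw [Nat.cast_sub (by omega)]; push_cast; linarith
  rw [← div_div, div_pow]
  gcongr

/-- Sieve with all products of `m` good primes `p ≤ y`, where `y` is about `l ^ 30` and `l = log N`.
There are `≫ l ^ 29` such primes, each of weight `≫ 1 / l`; after the loss `m! ≤ l ^ m` the sieve
sum is `≥ (l ^ 26) ^ m`. -/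
theorem card_filter_le_of_many_primes {T C D : Set ℕ} {x₀ : ℕ} (hCD : SumsInQ T C D x₀)
    {c : ℝ} (hc : 0 < c) {N y : ℕ} (hN : 1 ≤ N) (hl3 : 3 ≤ Real.log N)
    (hc1 : 128 ≤ c * Real.log N) (hc2 : 32 ≤ c ^ 2 * Real.log N)
    (hyl : (y : ℝ) ≤ Real.log N ^ 30) (hly : Real.log N ^ 30 / 2 ≤ y)
    (hyC : y ≤ (upTo C N).card)
    (hyP : c * y ≤ ∑ p ∈ upTo {p | p.Prime ∧ p ∉ T} y, Real.log p) :
    (((upTo D N).filter (x₀ ≤ ·)).card : ℝ) ≤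
      24 * Real.log N ^ 26 * Real.exp (17 / 30 * Real.log N) := by
  set l := Real.log N with hl
  have hl0 : 0 < l := by linarith
  have hy2r : (2 : ℝ) ≤ y := by
    refine le_trans ?_ hly
    have : (3 : ℝ) ^ 30 ≤ l ^ 30 := pow_le_pow_left₀ (by norm_num) hl3 30
    norm_num at this
    linarith
  have hy2 : 2 ≤ y := by exact_mod_cast hy2r
  have hyN : y ≤ N := by
    refine hyC.trans ?_
    have h1 : (upTo C N).card ≤ (Finset.Icc 1 N).card := Finset.card_le_card fun p hp =>
      Finset.mem_Icc.2 (mem_upTo.1 hp).1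
    rw [Nat.card_Icc] at h1
    omega
  obtain ⟨G, hG, hGcard, hGres⟩ := exists_many_primes_with_many_residues
    (P := {p | p.Prime ∧ p ∉ T}) (fun p hp => hp.1) hc hy2 hyC
    (fun a ha => (mem_upTo.1 ha).1.2) (by linarith) hyP
  have hlogy : Real.log y ≤ l := Real.log_le_log (by linarith) (by exact_mod_cast hyN)
  have hGl : c * l ^ 29 / 4 ≤ G.card := by
    have h1 : c * y / 2 ≤ G.card * l :=
      hGcard.trans (mul_le_mul_of_nonneg_left hlogy (by positivity))
    have h2 : c * (l ^ 30 / 2) ≤ c * y := mul_le_mul_of_nonneg_left hly hc.le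
    refine le_of_mul_le_mul_right ?_ hl0
    calc c * l ^ 29 / 4 * l = c * (l ^ 30 / 2) / 2 := by ring
      _ ≤ _ := by linarith
  have hlogl : 1 ≤ Real.log l := by
    rw [Real.le_log_iff_exp_le hl0]
    linarith [Real.exp_one_lt_d9]
  -- The largest `m` with `l ^ (60 * m) ≤ N`, so that `(y ^ m) ^ 2 ≤ N`.
  set m := ⌊l / (60 * Real.log l)⌋₊ with hm
  have hm1 : (m : ℝ) * (60 * Real.log l) ≤ l := by
    rw [← le_div_iff₀ (by positivity)]
    exact Nat.floor_le (by positivity)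
  have hm2 : l ≤ (m + 1) * (60 * Real.log l) := by
    rw [← div_le_iff₀ (by positivity)]
    exact (Nat.lt_floor_add_one _).le
  have hml : (m : ℝ) ≤ l := by
    refine le_trans ?_ hm1
    exact le_mul_of_one_le_right (by positivity) (by linarith)
  have hGm : 2 * l ≤ G.card := by
    refine le_trans ?_ hGl
    have h1 : 1 ≤ l ^ 27 := one_le_pow₀ (by linarith)
    calc 2 * l ≤ 128 * 1 * l / 4 := by linarith
      _ ≤ (c * l) * l ^ 27 * l / 4 := by gcongr
      _ = _ := by ring
  have hPP : ∀ p ∈ G, p.Prime ∧ p ∉ T := fun p hp => (mem_upTo.1 (hG hp)).2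
  have hexpN : Real.exp l = N := Real.exp_log (by exact_mod_cast hN)
  have hexpl : Real.exp (Real.log l) = l := Real.exp_log hl0
  have hls := large_sieve_summand_density hCD (C' := upTo C N)
    (fun a ha => (mem_upTo.1 ha).2) hPP hN (Fam := G.powersetCard m) (fun S hS => by
      obtain ⟨h1, h2⟩ := Finset.mem_powersetCard.1 hS
      refine ⟨h1, ?_⟩
      have h3 : ∏ p ∈ S, p ≤ y ^ m := by
        rw [← h2]
        exact Finset.prod_le_pow_card _ _ _ fun p hp => (mem_upTo.1 (hG (h1 hp))).1.2
      have h4 : ((y : ℝ) ^ m) ^ 2 ≤ N := by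
        calc ((y : ℝ) ^ m) ^ 2 ≤ ((l ^ 30) ^ m) ^ 2 := by gcongr
          _ = Real.exp (m * (60 * Real.log l)) := by
            rw [← hexpl, ← Real.exp_nat_mul, ← Real.exp_nat_mul, ← Real.exp_nat_mul, hexpl]
            congr 1
            push_cast
            ring
          _ ≤ Real.exp l := Real.exp_le_exp.2 hm1
          _ = N := hexpN
      have h5 : (y ^ m) ^ 2 ≤ N := by exact_mod_cast h4
      exact (Nat.pow_le_pow_left h3 2).trans (by omega))
  set X := (((upTo D N).filter (x₀ ≤ ·)).card : ℝ)
  have hlower : (l ^ 26) ^ m ≤ ∑ S ∈ G.powersetCard m, ∏ p ∈ S,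
      (((upTo C N).image (· % p)).card / p : ℝ) := by
    have h1 : ∀ S ∈ G.powersetCard m, (c / (4 * l)) ^ m ≤
        ∏ p ∈ S, (((upTo C N).image (· % p)).card / p : ℝ) := by
      intro S hS
      obtain ⟨h1, h2⟩ := Finset.mem_powersetCard.1 hS
      rw [← h2, ← Finset.prod_const]
      refine Finset.prod_le_prod (fun p _ => by positivity) fun p hp => ?_
      obtain ⟨⟨h3, h4⟩, -⟩ := mem_upTo.1 (hG (h1 hp))
      have hp0 : (0 : ℝ) < p := by exact_mod_cast h3
      have hpy : (p : ℝ) ≤ y := by exact_mod_cast h4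
      rw [le_div_iff₀ hp0]
      refine le_trans ?_ (hGres p (h1 hp))
      rw [div_mul_eq_mul_div]
      gcongr
    have h2 := Finset.sum_le_sum h1
    rw [Finset.sum_const, nsmul_eq_mul, Finset.card_powersetCard] at h2
    refine le_trans ?_ h2
    refine le_trans ?_ (mul_le_mul_of_nonneg_right (pow_le_choose_mul hl0 hml hGm) (by positivity))
    rw [← mul_pow]
    refine pow_le_pow_left₀ (by positivity) ?_ m
    calc l ^ 26 = 32 * l ^ 26 / 32 := by ring
      _ ≤ (c ^ 2 * l) * l ^ 26 / 32 := by gcongr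
      _ = c * l ^ 29 / 4 / (2 * l) * (c / (4 * l)) := by field_simp; ring
      _ ≤ G.card / (2 * l) * (c / (4 * l)) := by gcongr
  have h1 : X * (l ^ 26) ^ m ≤ 24 * N :=
    (mul_le_mul_of_nonneg_left hlower (by positivity)).trans hls
  -- Here `13 / 30 = 26 / 60`; the extra factor `l ^ 26` pays for rounding `m` down.
  have h2 : Real.exp (13 / 30 * l) ≤ (l ^ 26) ^ m * l ^ 26 := by
    rw [← pow_succ, ← pow_mul]
    conv_rhs => rw [← hexpl]
    rw [← Real.exp_nat_mul]
    refine Real.exp_le_exp.2 ?_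
    push_cast
    nlinarith
  have h3 : X * Real.exp (13 / 30 * l) ≤ 24 * N * l ^ 26 := by
    calc X * Real.exp (13 / 30 * l) ≤ X * ((l ^ 26) ^ m * l ^ 26) := by gcongr
      _ = X * (l ^ 26) ^ m * l ^ 26 := by ring
      _ ≤ _ := by gcongr
  refine le_of_mul_le_mul_right (h3.trans (le_of_eq ?_)) (Real.exp_pos (13 / 30 * l))
  rw [mul_assoc _ (Real.exp _) (Real.exp _), ← Real.exp_add, ← hexpN]
  rw [show 17 / 30 * l + 13 / 30 * l = l by ring]
  ring

/-- The conclusion is conditional on `Q T` being large at `N`, so that one and the same `N` serves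
all three groupings of a ternary decomposition. -/
theorem eventually_card_summand_le_rpow {T C D : Set ℕ} (hT : ∀ p ∈ T, p.Prime) {τ E : ℝ}
    (hτ0 : 0 < τ) (hτ1 : τ < 1) (hE : ∀ N : ℕ, 1 ≤ N → |logSum T N - τ * Real.log N| ≤ E)
    {x₀ : ℕ} (hCD : SumsInQ T C D x₀) (hcov : SumsCoverQ T C D x₀)
    (hC0 : ∀ c ∈ C, 0 < c) (hD0 : ∀ d ∈ D, 0 < d) (hC2 : 2 ≤ C.encard) {s : ℝ} (hs : s < 1) :
    ∀ᶠ N : ℕ in atTop, (N : ℝ) / Real.log N ^ s < (upTo (Q T) N).card →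
      ((upTo D N).card : ℝ) ≤ (N : ℝ) ^ (3 / 5 : ℝ) := by
  have hinf := summand_infinite hT hτ0 hτ1 hE hCD hcov hC0 hD0 hC2
  obtain ⟨k, hk⟩ := exists_nat_gt (32 / (1 - τ))
  -- The exponent `32` exceeds the required `30` by `1` for the density loss `N / log N` of `Q T`
  -- and by `1` for slack.
  have hk' : (32 : ℝ) < k * (1 - τ) := by rwa [div_lt_iff₀ (by linarith)] at hk
  have hk1 : 1 ≤ k := by
    by_contra hcon
    have : k = 0 := by omega
    rw [this] at hk'
    norm_num at hk'
  obtain ⟨C', hC', hcard⟩ := hinf.exists_subset_card_eq k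
  have ev1 := eventually_card_summand_le (C' := C') hτ0 hτ1 hE hCD (fun c hc => hC' hc)
    (by omega) (s := 32) (by rw [hcard]; exact hk')
  have ev2 := eventually_const_mul_div_le hs x₀ 1
  obtain ⟨c, hc, hcy⟩ := exists_sum_log_ge (P := {p | p.Prime ∧ p ∉ T}) (σ := 1 - τ)
    (by linarith) (exists_abs_logSum_compl_sub_le hT hE)
  have hytop : Tendsto (fun N : ℕ => ⌊Real.log N ^ 30⌋₊) atTop atTop :=
    tendsto_nat_floor_atTop.comp ((tendsto_pow_atTop (by norm_num)).comp tendsto_log_natCast)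
  have ev3 := hytop.eventually hcy
  -- The margin is `3 / 5 - 17 / 30 = 1 / 30`; `48 = 2 * 24` leaves half of the bound for the
  -- elements below `x₀`.
  have ev4 : ∀ᶠ N : ℕ in atTop, 48 * Real.log N ^ 26 ≤ Real.exp (1 / 30 * Real.log N) := by
    have h1 := ((isLittleO_pow_exp_pos_mul_atTop (k := 26) (b := 1 / 30) (by norm_num)).comp_tendsto
      tendsto_log_natCast).def (c := 1 / 48) (by norm_num)
    filter_upwards [h1] with N h2
    simp only [Function.comp, Real.norm_eq_abs, Real.abs_exp] at h2
    linarith [le_abs_self (Real.log N ^ 26)]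
  have ev5 : ∀ᶠ N : ℕ in atTop, 2 * (x₀ : ℝ) ≤ Real.exp (3 / 5 * Real.log N) :=
    (Real.tendsto_exp_atTop.comp
      (tendsto_log_natCast.const_mul_atTop (by norm_num))).eventually_ge_atTop _
  have ev6 := tendsto_log_natCast.eventually_ge_atTop (max 3 (max (128 / c) (32 / c ^ 2)))
  filter_upwards [ev1, ev2, ev3, ev4, ev5, ev6, eventually_ge_atTop 1]
    with N h1 h2 h3 h4 h5 h6 h7 hS
  have hNr : (0 : ℝ) < N := by exact_mod_cast h7
  have hl3 : 3 ≤ Real.log N := (le_max_left _ _).trans h6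
  have hc1 : 128 / c ≤ Real.log N := (le_max_left _ _).trans ((le_max_right _ _).trans h6)
  have hc2 : 32 / c ^ 2 ≤ Real.log N := (le_max_right _ _).trans ((le_max_right _ _).trans h6)
  rw [div_le_iff₀ (by positivity), mul_comm] at hc1 hc2
  have hpow : (3 : ℝ) ^ 30 ≤ Real.log N ^ 30 := pow_le_pow_left₀ (by norm_num) hl3 30
  norm_num at hpow
  have hfl := Nat.floor_le (a := Real.log N ^ 30) (by positivity)
  have hfl' := Nat.lt_floor_add_one (Real.log N ^ 30)
  have hcount : ((upTo (Q T) N).card : ℝ) ≤ x₀ + (upTo C N).card * (upTo D N).card := by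
    exact_mod_cast card_upTo_Q_le hcov hC0 hD0 N
  have hClarge : Real.log N ^ 30 ≤ (upTo C N).card := by
    have h8 : (upTo C N).card * ((upTo D N).card : ℝ) ≤
        (upTo C N).card * (N / Real.log N ^ (32 : ℝ)) := by gcongr
    rw [one_mul, Real.rpow_one] at h2
    have h9 : N / Real.log N < (upTo C N).card * (N / Real.log N ^ (32 : ℝ)) := by linarith
    have h10 : Real.log N ^ (32 : ℝ) = Real.log N ^ 32 := by exact_mod_cast Real.rpow_natCast _ 32
    rw [h10, mul_div_assoc', div_lt_div_iff₀ (by linarith) (by positivity)] at h9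
    have h11 : N * Real.log N * Real.log N ^ 31 < N * Real.log N * (upTo C N).card := by
      calc N * Real.log N * Real.log N ^ 31 = N * Real.log N ^ 32 := by ring
        _ < _ := h9
        _ = _ := by ring
    have h12 := lt_of_mul_lt_mul_left h11 (by positivity)
    refine le_trans ?_ h12.le
    exact pow_le_pow_right₀ (by linarith) (by norm_num)
  have hmain := card_filter_le_of_many_primes hCD hc h7 hl3 hc1 hc2 hfl (by linarith)
    (by exact_mod_cast hfl.trans hClarge) h3
  have h8 : ((upTo D N).card : ℝ) ≤ x₀ + ((upTo D N).filter (x₀ ≤ ·)).card := by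
    exact_mod_cast card_upTo_le_add_filter D x₀ N
  have h9 : (N : ℝ) ^ (3 / 5 : ℝ) = Real.exp (3 / 5 * Real.log N) := by
    rw [Real.rpow_def_of_pos hNr, mul_comm]
  have h10 : 48 * Real.log N ^ 26 * Real.exp (17 / 30 * Real.log N) ≤
      Real.exp (3 / 5 * Real.log N) := by
    calc _ ≤ Real.exp (1 / 30 * Real.log N) * Real.exp (17 / 30 * Real.log N) := by gcongr
      _ = _ := by rw [← Real.exp_add]; congr 1; ring
  rw [h9]
  linarith

/-! ### The contradiction for three summands -/

theorem card_Q_le_of_ternary {T A B C : Set ℕ} {x₀ : ℕ} (hA0 : ∀ a ∈ A, 0 < a)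
    (hB0 : ∀ b ∈ B, 0 < b) (hC0 : ∀ c ∈ C, 0 < c)
    (hcov : ∀ n ∈ Q T, x₀ ≤ n → ∃ a ∈ A, ∃ b ∈ B, ∃ c ∈ C, a + b + c = n) (N : ℕ) :
    ((upTo (Q T) N).filter (x₀ ≤ ·)).card ^ 2 ≤
      (upTo (A + B) N).card * (upTo (B + C) N).card * (upTo (A + C) N).card := by
  refine card_triple_sum_sq_le (A := A) (B := B) (C := C) (fun n hn => ?_)
    fun a ha b hb c hc hsum => ?_
  · obtain ⟨h1, h2⟩ := Finset.mem_filter.1 hn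
    exact hcov n (mem_upTo.1 h1).2 h2
  · have hle := (mem_upTo.1 (Finset.mem_filter.1 hsum).1).1.2
    have h1 := hA0 a ha
    have h2 := hB0 b hb
    have h3 := hC0 c hc
    exact ⟨mem_upTo.2 ⟨⟨by omega, by omega⟩, Set.add_mem_add ha hb⟩,
      mem_upTo.2 ⟨⟨by omega, by omega⟩, Set.add_mem_add hb hc⟩,
      mem_upTo.2 ⟨⟨by omega, by omega⟩, Set.add_mem_add ha hc⟩⟩

theorem not_hasTernaryDecomposition_Q {T : Set ℕ} (hT : ∀ p ∈ T, p.Prime) {τ E : ℝ} (hτ0 : 0 < τ)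
    (hτ1 : τ < 1) (hE : ∀ N : ℕ, 1 ≤ N → |logSum T N - τ * Real.log N| ≤ E) :
    ¬ HasTernaryDecomposition (Q T) := by
  rintro ⟨A, B, C, ⟨hA0, hA2⟩, ⟨hB0, hB2⟩, ⟨hC0, hC2⟩, x₀, hx₀⟩
  have hin : ∀ a ∈ A, ∀ b ∈ B, ∀ c ∈ C, x₀ ≤ a + b + c → a + b + c ∈ Q T :=
    fun a ha b hb c hc h => by
      have : a + b + c ∈ (A + B + C) ∩ Set.Ici x₀ :=
        ⟨Set.add_mem_add (Set.add_mem_add ha hb) hc, h⟩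
      rw [hx₀] at this
      exact this.1
  have hcov : ∀ n ∈ Q T, x₀ ≤ n → ∃ a ∈ A, ∃ b ∈ B, ∃ c ∈ C, a + b + c = n := fun n hn h => by
    have : n ∈ Q T ∩ Set.Ici x₀ := ⟨hn, h⟩
    rw [← hx₀] at this
    obtain ⟨d, ⟨a, ha, b, hb, rfl⟩, c, hc, rfl⟩ := this.1
    exact ⟨a, ha, b, hb, c, hc, rfl⟩
  have hpos : ∀ U V : Set ℕ, (∀ u ∈ U, 0 < u) → (∀ v ∈ V, 0 < v) → ∀ d ∈ U + V, 0 < d := by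
    rintro U V hU hV _ ⟨u, hu, v, hv, rfl⟩
    exact Nat.add_pos_left (hU u hu) v
  obtain ⟨s, hs, hs1⟩ := exists_between (show 1 - τ < 1 by linarith)
  have evAB := eventually_card_summand_le_rpow (C := C) (D := A + B) (x₀ := x₀) hT hτ0 hτ1 hE
    (by
      rintro c hc _ ⟨a, ha, b, hb, rfl⟩ h
      have e : c + (a + b) = a + b + c := by ring
      simp only [e] at h ⊢
      exact hin a ha b hb c hc h)
    (by
      intro n hn h
      obtain ⟨a, ha, b, hb, c, hc, rfl⟩ := hcov n hn h
      exact ⟨c, hc, a + b, Set.add_mem_add ha hb, by ring⟩)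
    hC0 (hpos A B hA0 hB0) hC2 hs1
  have evBC := eventually_card_summand_le_rpow (C := A) (D := B + C) (x₀ := x₀) hT hτ0 hτ1 hE
    (by
      rintro a ha _ ⟨b, hb, c, hc, rfl⟩ h
      have e : a + (b + c) = a + b + c := by ring
      simp only [e] at h ⊢
      exact hin a ha b hb c hc h)
    (by
      intro n hn h
      obtain ⟨a, ha, b, hb, c, hc, rfl⟩ := hcov n hn h
      exact ⟨a, ha, b + c, Set.add_mem_add hb hc, by ring⟩)
    hA0 (hpos B C hB0 hC0) hA2 hs1
  have evAC := eventually_card_summand_le_rpow (C := B) (D := A + C) (x₀ := x₀) hT hτ0 hτ1 hE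
    (by
      rintro b hb _ ⟨a, ha, c, hc, rfl⟩ h
      have e : b + (a + c) = a + b + c := by ring
      simp only [e] at h ⊢
      exact hin a ha b hb c hc h)
    (by
      intro n hn h
      obtain ⟨a, ha, b, hb, c, hc, rfl⟩ := hcov n hn h
      exact ⟨b, hb, a + c, Set.add_mem_add ha hc, by ring⟩)
    hB0 (hpos A C hA0 hC0) hB2 hs1
  have ev1 := eventually_const_mul_div_le hs1 x₀ 1
  -- The exponent is the gap `2 - 3 * (3 / 5) = 1 / 5` between the square of the trivial bound and
  -- the product of the three pair-sum bounds.
  have ev2 : ∀ᶠ N : ℕ in atTop, 2 * Real.log N ^ 2 ≤ Real.exp (1 / 5 * Real.log N) := by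
    have h1 := ((isLittleO_pow_exp_pos_mul_atTop (k := 2) (b := 1 / 5) (by norm_num)).comp_tendsto
      tendsto_log_natCast).def (c := 1 / 2) (by norm_num)
    filter_upwards [h1] with N h2
    simp only [Function.comp, Real.norm_eq_abs, Real.abs_exp] at h2
    linarith [le_abs_self (Real.log N ^ 2)]
  obtain ⟨N, hS, hAB, hBC, hAC, h1, h2, h3⟩ := ((frequently_card_Q_ge hT hτ1 hE hs hs1).and_eventually
    (evAB.and (evBC.and (evAC.and (ev1.and (ev2.and
      (tendsto_log_natCast.eventually_ge_atTop 1))))))).exists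
  replace hAB := hAB hS
  replace hBC := hBC hS
  replace hAC := hAC hS
  have hl : 0 < Real.log N := by linarith
  have hNr : (0 : ℝ) < N := by
    rcases Nat.eq_zero_or_pos N with rfl | h
    · simp at hl
    · exact_mod_cast h
  rw [one_mul, Real.rpow_one] at h1
  have h4 : ((upTo (Q T) N).card : ℝ) ≤ x₀ + ((upTo (Q T) N).filter (x₀ ≤ ·)).card := by
    exact_mod_cast card_upTo_le_add_filter (Q T) x₀ N
  have h5 : ((((upTo (Q T) N).filter (x₀ ≤ ·)).card : ℕ) : ℝ) ^ 2 ≤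
      (upTo (A + B) N).card * (upTo (B + C) N).card * (upTo (A + C) N).card := by
    exact_mod_cast card_Q_le_of_ternary hA0 hB0 hC0 hcov N
  have h6 : ((upTo (A + B) N).card : ℝ) * (upTo (B + C) N).card * (upTo (A + C) N).card ≤
      (N : ℝ) ^ (3 / 5 : ℝ) * (N : ℝ) ^ (3 / 5 : ℝ) * (N : ℝ) ^ (3 / 5 : ℝ) := by gcongr
  have h7 : N / Real.log N ≤ (((upTo (Q T) N).filter (x₀ ≤ ·)).card : ℝ) := by linarith
  have h8 : (N / Real.log N) ^ 2 ≤ (N : ℝ) ^ (3 / 5 : ℝ) * (N : ℝ) ^ (3 / 5 : ℝ) *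
      (N : ℝ) ^ (3 / 5 : ℝ) :=
    (pow_le_pow_left₀ (by positivity) h7 2).trans (h5.trans h6)
  have h9 : (N : ℝ) ^ (3 / 5 : ℝ) * (N : ℝ) ^ (3 / 5 : ℝ) * (N : ℝ) ^ (3 / 5 : ℝ) *
      Real.exp (1 / 5 * Real.log N) = (N : ℝ) ^ 2 := by
    have : Real.exp (1 / 5 * Real.log N) = (N : ℝ) ^ (1 / 5 : ℝ) := by
      rw [Real.rpow_def_of_pos hNr, mul_comm]
    rw [this, ← Real.rpow_add hNr, ← Real.rpow_add hNr, ← Real.rpow_add hNr, ← Real.rpow_natCast]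
    norm_num
  rw [div_pow, div_le_iff₀ (by positivity), ← h9] at h8
  have h10 : 0 < (N : ℝ) ^ (3 / 5 : ℝ) * (N : ℝ) ^ (3 / 5 : ℝ) * (N : ℝ) ^ (3 / 5 : ℝ) := by
    positivity
  have h11 := le_of_mul_le_mul_left h8 h10
  have h12 : 0 < Real.log N ^ 2 := by positivity
  linarith

end AdditiveDecomposition

theorem mainTheorem6 (T : Set ℕ) (hT : ∀ p ∈ T, p.Prime)
    (τ C : ℝ) (hτ0 : 0 < τ) (hτ1 : τ < 1)
    (hsum : (fun x : ℝ => AdditiveDecomposition.logSum T x - (τ * Real.log x + C))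
      =o[atTop] (fun _ : ℝ => (1 : ℝ))) :
    ¬ AdditiveDecomposition.HasTernaryDecomposition (AdditiveDecomposition.Q T) := by
  obtain ⟨E, hE⟩ := AdditiveDecomposition.exists_abs_logSum_sub_le hτ0 hsum
  exact AdditiveDecomposition.not_hasTernaryDecomposition_Q hT hτ0 hτ1 hE
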